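/- For complex $\mu,\nu$ and $z>0$ let $$s_{\mu,\nu}(z)=z^{\mu+1}\sum_{k=0}^\infty\frac{(-1)^k z^{2k}}{\prod_{m=1}^{k+1}\left((\mu+2m-1)^2-\nu^2\right)}$$ and let the Lommel function $S_{\mu,\nu}$ be $$S_{\mu,\nu}(z)=s_{\mu,\nu}(z)+2^{\mu-1}\Gamma\left(\tfrac{\mu+\nu+1}{2}\right)\Gamma\left(\tfrac{\mu-\nu+1}{2}\right)\left(\sin\left(\tfrac{(\mu-\nu)\pi}{2}\right)J_\nu(z)-\cos\left(\tfrac{(\mu-\nu)\pi}{2}\right)Y_\nu(z)\right),$$ where $J_\nu$, $Y_\nu$ are the Bessel functions of the first and second kind; when $\mu+\nu$ or $\mu-\nu$ is an odd negative integer, $S_{\mu,\nu}(z)$ is the limit of $S_{\mu',\nu}(z)$ as $\mu'\to\mu$, $\mu'\ne\mu$. There is an absolute constant $C>0$ (independent of $x$, $\mu$ and $n$) such that for all real $x>0$, all complex $\mu$ with $-\tfrac54<\operatorname{Re}\mu<\tfrac34$ and all integers $n\ge 1$, $$\left|S_{\mu,in}(x)\right|\le\frac{C\,x^{-1/4}}{[\sinh(\pi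 n)]^{1/2}\left|\Gamma\left(\tfrac{1-\mu-in}{2}\right)\Gamma\left(\tfrac{1-\mu+in}{2}\right)\right|}.$$ -/

import Mathlib

open Filter Topology

noncomputable section

/-- The Bessel function of the first kind, `J_ν(z) = (z/2)^ν ∑ (-1)^k (z²/4)^k / (k! Γ(ν+k+1))`,
with the principal branch of the power.  In Mathlib `Γ` takes the value `0` at its poles, so that
`1 / Γ` is here the entire reciprocal gamma function. -/
def besselJ (ν z : ℂ) : ℂ :=
  (z / 2) ^ ν *
    ∑' k : ℕ, (-1 : ℂ) ^ k * (z ^ 2 / 4) ^ k / ((k.factorial : ℂ) * Complex.Gamma (ν + k + 1))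

/-- The quotient `(J_ν(z) cos(πν) - J_{-ν}(z)) / sin(πν)`, for `ν` not an integer. -/
def besselYQuotient (ν z : ℂ) : ℂ :=
  (besselJ ν z * Complex.cos (Real.pi * ν) - besselJ (-ν) z) / Complex.sin (Real.pi * ν)

open Classical in
/-- The Bessel function of the second kind `Y_ν(z)`; at an integer order it is the limit
of the values at nearby orders. -/
def besselY (ν z : ℂ) : ℂ :=
  if ∃ m : ℤ, ν = m then limUnder (𝓝[≠] ν) (fun ν' => besselYQuotient ν' z)
  else besselYQuotient ν z

/-- The Lommel function
`s_{μ,ν}(z) = z^(μ+1) ∑_k (-1)^k z^(2k) / ∏_{m=1}^{k+1} ((μ+2m-1)² - ν²)`, defined when neither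
`μ + ν` nor `μ - ν` is an odd negative integer. -/
def lommels (μ ν z : ℂ) : ℂ :=
  z ^ (μ + 1) *
    ∑' k : ℕ, (-1 : ℂ) ^ k * z ^ (2 * k) /
      ∏ m ∈ Finset.Icc 1 (k + 1), ((μ + 2 * (m : ℂ) - 1) ^ 2 - ν ^ 2)

/-- The companion of `s_{μ,ν}` at regular parameters. -/
def lommelSRegular (μ ν z : ℂ) : ℂ :=
  lommels μ ν z +
    (2 : ℂ) ^ (μ - 1) * Complex.Gamma ((μ + ν + 1) / 2) * Complex.Gamma ((μ - ν + 1) / 2) *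
      (Complex.sin ((μ - ν) / 2 * Real.pi) * besselJ ν z -
        Complex.cos ((μ - ν) / 2 * Real.pi) * besselY ν z)

open Classical in
/-- The Lommel function `S_{μ,ν}(z)`.  When `μ + ν` or `μ - ν` is an odd negative integer, where the
two summands of the regular formula have poles that cancel, it is the limit in `μ`. -/
def lommelS (μ ν z : ℂ) : ℂ :=
  if ∃ k : ℕ, μ + ν = -(2 * (k : ℂ) + 1) ∨ μ - ν = -(2 * (k : ℂ) + 1) then
    limUnder (𝓝[≠] μ) (fun μ' => lommelSRegular μ' ν z)
  else lommelSRegular μ ν z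

end

open MeasureTheory Set

/-! For `-2 < Re μ < 1` there is the representation (`lommelS_eq_lommelRepr`) `S_{μ,in}(e^s) =
2^{μ+1} / (Γ((1-μ-in)/2) Γ((1-μ+in)/2)) · ∫ e^{-μv} / (2 cosh v) · K_{in}(e^{s+v}) dv`. When `-5/4 ≤
Re μ ≤ 3/4` the kernel is at most `e^{v/4}` in modulus, so a shift of `v` extracts `e^{-s/4} =
x^{-1/4}`, and everything reduces to `∫ e^{v/4} |K_{in}(e^v)| dv ≤ 20 / √sinh(πn)`
(`integral_exp_mul_abs_macdonald_le`).

That estimate is an energy argument. In the logarithmic variable `K(s) = K_{in}(e^s)` satisfies `K''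
= (e^{2s} - n²) K`, and `E = K'² + (n² - e^{2s}) K²` has `E' = -2 e^{2s} K²`. It decreases from
`|Γ(1+in)|² = πn / sinh(πn)` at `-∞` to `0` at `+∞`. Monotonicity bounds `K` pointwise below the
turning point `e^s = n`; the total drop bounds `∫ e^{2s} K²`, which controls the tail.

The representation is proved first for `|Re μ| < 1` by uniqueness: both sides solve the same
inhomogeneous Bessel equation and have the same oscillating behaviour at `s → -∞`
(`eq_zero_of_bessel_ode`, `connection_coefficient`). The identity theorem in `μ`, after
multiplication by `(μ+1)² + n²` to clear poles, extends it to `-2 < Re μ < 1`. -/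

/-! ### Products of Gamma functions as integrals in logarithmic variables. -/

theorem integrable_cexp_mul_sub_exp {p : ℂ} (hp : 0 < p.re) :
    Integrable (fun x : ℝ => Complex.exp (p * x - Real.exp x)) ∧
      ∫ x : ℝ, Complex.exp (p * x - Real.exp x) = Complex.Gamma p := by
  have himg : Real.exp '' univ = Ioi 0 := by rw [image_univ, Real.range_exp]
  have key : ∀ x : ℝ, |Real.exp x| • ((Real.exp (-Real.exp x) : ℂ) * (Real.exp x : ℂ) ^ (p - 1)) =
      Complex.exp (p * x - Real.exp x) := by
    intro x
    rw [abs_of_pos (Real.exp_pos x), Complex.cpow_def_of_ne_zero (by exact_mod_cast (Real.exp_pos x).ne'),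
      ← Complex.ofReal_log (Real.exp_pos x).le, Real.log_exp, Complex.real_smul, Complex.ofReal_exp,
      Complex.ofReal_exp, ← Complex.exp_add, ← Complex.exp_add]
    push_cast
    ring_nf
  have hd : ∀ x ∈ (univ : Set ℝ), HasDerivWithinAt Real.exp (Real.exp x) univ x :=
    fun x _ => (Real.hasDerivAt_exp x).hasDerivWithinAt
  constructor
  · have h := Complex.GammaIntegral_convergent hp
    rw [← himg, integrableOn_image_iff_integrableOn_abs_deriv_smul MeasurableSet.univ hd
      Real.exp_injective.injOn, integrableOn_univ] at h
    simpa only [key] using h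
  · rw [Complex.Gamma_eq_integral hp, Complex.GammaIntegral, ← himg,
      integral_image_eq_integral_abs_deriv_smul MeasurableSet.univ hd Real.exp_injective.injOn,
      setIntegral_univ]
    simp only [key]

/-- This shear recentres the convolution variable at `w / 2`, making the product of two Gamma
integrands symmetric: the two exponentials combine into `2 e^{w/2} cosh u`. -/
theorem measurePreserving_prod_add_half :
    MeasurePreserving (fun z : ℝ × ℝ => (z.1, z.2 + z.1 / 2)) (volume.prod volume)
      (volume.prod volume) :=
  (MeasurePreserving.id volume).skew_product (g := fun w u : ℝ => u + w / 2) (by fun_prop)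
    (Eventually.of_forall fun w => (measurePreserving_add_right volume (w / 2)).map_eq)

theorem cexp_mul_cexp_eq (p q : ℂ) (w u : ℝ) :
    Complex.exp (p * ((u + w / 2 : ℝ) : ℂ) - Real.exp (u + w / 2)) *
      Complex.exp (q * ((w - (u + w / 2) : ℝ) : ℂ) - Real.exp (w - (u + w / 2))) =
    Complex.exp ((p + q) * (w / 2) + (p - q) * u -
      ((2 * Real.exp (w / 2) * Real.cosh u : ℝ) : ℂ)) := by
  rw [← Complex.exp_add]
  congr 1
  have : (2 * Real.exp (w / 2) * Real.cosh u : ℝ) = Real.exp (u + w / 2) + Real.exp (w - (u + w / 2)) := by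
    rw [Real.cosh_eq, show w - (u + w / 2) = w / 2 + -u by ring, Real.exp_add, Real.exp_add]
    ring
  rw [this]
  push_cast
  ring

theorem integrable_Gamma_mul_Gamma_kernel {p q : ℂ} (hp : 0 < p.re) (hq : 0 < q.re) :
    Integrable (fun z : ℝ × ℝ => Complex.exp ((p + q) * (z.1 / 2) + (p - q) * z.2 -
      ((2 * Real.exp (z.1 / 2) * Real.cosh z.2 : ℝ) : ℂ))) (volume.prod volume) := by
  have h := (integrable_cexp_mul_sub_exp hp).1.convolution_integrand (ContinuousLinearMap.mul ℝ ℂ)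
    (integrable_cexp_mul_sub_exp hq).1
  have h2 := measurePreserving_prod_add_half.integrable_comp_of_integrable h
  refine h2.congr (Eventually.of_forall fun z => ?_)
  simp only [Function.comp, ContinuousLinearMap.mul_apply']
  exact cexp_mul_cexp_eq p q z.1 z.2

theorem Gamma_mul_Gamma_eq_integral {p q : ℂ} (hp : 0 < p.re) (hq : 0 < q.re) :
    Complex.Gamma p * Complex.Gamma q = ∫ w : ℝ, ∫ u : ℝ, Complex.exp ((p + q) * (w / 2) + (p - q) * u -
      ((2 * Real.exp (w / 2) * Real.cosh u : ℝ) : ℂ)) := by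
  have h := integral_convolution (ContinuousLinearMap.mul ℝ ℂ) (integrable_cexp_mul_sub_exp hp).1
    (integrable_cexp_mul_sub_exp hq).1
  rw [(integrable_cexp_mul_sub_exp hp).2, (integrable_cexp_mul_sub_exp hq).2] at h
  rw [ContinuousLinearMap.mul_apply'] at h
  rw [← h]
  refine integral_congr_ae (Eventually.of_forall fun w => ?_)
  simp only [convolution, ContinuousLinearMap.mul_apply']
  rw [← integral_add_right_eq_self _ (w / 2)]
  simp only [cexp_mul_cexp_eq]

/-- `∫ e^{-av} / (2 cosh v) dv = ½ Γ((1-a)/2) Γ((1+a)/2)`. -/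
theorem integral_cexp_div_cosh {a : ℂ} (h1 : -1 < a.re) (h2 : a.re < 1) :
    ∫ v : ℝ, Complex.exp (-a * v) / ((2 * Real.cosh v : ℝ) : ℂ) =
      1 / 2 * (Complex.Gamma ((1 - a) / 2) * Complex.Gamma ((1 + a) / 2)) := by
  have hp : 0 < ((1 - a) / 2).re := by simp; linarith
  have hq : 0 < ((1 + a) / 2).re := by simp; linarith
  -- The two arguments sum to `1`, so for fixed `u` the `w`-integral is a rescaled `Γ(1)` and yields
  -- `2 / (2 cosh u)`.
  rw [Gamma_mul_Gamma_eq_integral hp hq,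
    integral_integral_swap (integrable_Gamma_mul_Gamma_kernel hp hq), ← integral_const_mul]
  refine integral_congr_ae (Eventually.of_forall fun u => ?_)
  simp only
  set c : ℝ := 2 * Real.cosh u with hc
  have hcpos : 0 < c := by have := Real.cosh_pos u; positivity
  have e1 : ∀ w : ℝ, Complex.exp (((1 - a) / 2 + (1 + a) / 2) * (w / 2) + ((1 - a) / 2 - (1 + a) / 2) * u -
      ((2 * Real.exp (w / 2) * Real.cosh u : ℝ) : ℂ)) = Complex.exp (-a * u) / c *
      (fun x : ℝ => Complex.exp (1 * x - Real.exp x)) (w / 2 + Real.log c) := by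
    intro w
    have : (c : ℂ) = Complex.exp (Real.log c : ℝ) := by
      rw [← Complex.ofReal_exp, Real.exp_log hcpos]
    simp only
    rw [this, ← Complex.exp_sub, ← Complex.exp_add, Real.exp_add, Real.exp_log hcpos, hc]
    congr 1
    push_cast
    ring
  simp only [e1]
  rw [integral_const_mul, Measure.integral_comp_div (fun x : ℝ => (fun x : ℝ => Complex.exp (1 * x - Real.exp x)) (x + Real.log c)) 2,
    integral_add_right_eq_self (fun x : ℝ => Complex.exp (1 * x - Real.exp x)),
    (integrable_cexp_mul_sub_exp (p := 1) (by simp)).2]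
  simp
  ring

/-- A non-integrable function has Bochner integral `0` by convention, whereas the Gamma product
giving the value does not vanish. -/
theorem integrable_cexp_div_cosh {a : ℂ} (h1 : -1 < a.re) (h2 : a.re < 1) :
    Integrable fun v : ℝ => Complex.exp (-a * v) / ((2 * Real.cosh v : ℝ) : ℂ) := by
  have hp : 0 < ((1 - a) / 2).re := by simp; linarith
  have hq : 0 < ((1 + a) / 2).re := by simp; linarith
  by_contra hcon
  have h := integral_cexp_div_cosh h1 h2
  rw [integral_undef hcon] at h
  have := mul_ne_zero (Complex.Gamma_ne_zero_of_re_pos hp) (Complex.Gamma_ne_zero_of_re_pos hq)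
  simp_all

/-! ### The Macdonald function `K_{in}` and its differential equation. -/

theorem Real.sq_div_four_le_cosh (u : ℝ) : u ^ 2 / 4 ≤ Real.cosh u := by
  rw [← Real.cosh_abs, ← sq_abs, Real.cosh_eq]
  have h1 := Real.quadratic_le_exp_of_nonneg (abs_nonneg u)
  have h2 := Real.exp_pos (-|u|)
  have h3 := abs_nonneg u
  linarith

theorem integrable_cosh_pow_mul_exp (j : ℕ) {t : ℝ} (ht : 0 < t) :
    Integrable fun u : ℝ => Real.cosh u ^ j * Real.exp (-t * Real.cosh u) := by
  -- Half of the exponential absorbs `cosh u ^ j`; the other half is at most a Gaussian because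
  -- `cosh u ≥ u² / 4`.
  have h0 : Integrable fun u : ℝ => (j.factorial * (2 / t) ^ j) * Real.exp (-(t / 8) * u ^ 2) :=
    (integrable_exp_neg_mul_sq (by positivity)).const_mul _
  refine h0.mono' (Continuous.aestronglyMeasurable (by fun_prop)) (Eventually.of_forall fun u => ?_)
  have hc := Real.cosh_pos u
  rw [Real.norm_of_nonneg (by positivity)]
  have h1 := Real.pow_div_factorial_le_exp (t / 2 * Real.cosh u) (by positivity) j
  rw [div_le_iff₀ (by positivity), mul_pow] at h1
  have h2 : Real.cosh u ^ j ≤ j.factorial * (2 / t) ^ j * Real.exp (t / 2 * Real.cosh u) := by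
    calc Real.cosh u ^ j = (2 / t) ^ j * ((t / 2) ^ j * Real.cosh u ^ j) := by
          rw [← mul_assoc, ← mul_pow, show 2 / t * (t / 2) = 1 by field_simp]; simp
      _ ≤ (2 / t) ^ j * (Real.exp (t / 2 * Real.cosh u) * j.factorial) := by gcongr
      _ = _ := by ring
  calc _ ≤ j.factorial * (2 / t) ^ j * Real.exp (t / 2 * Real.cosh u) * Real.exp (-t * Real.cosh u) := by
        gcongr
    _ = j.factorial * (2 / t) ^ j * Real.exp (-(t / 2) * Real.cosh u) := by
        rw [mul_assoc, ← Real.exp_add]; ring_nf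
    _ ≤ _ := by
        gcongr ?_ * Real.exp ?_
        have := Real.sq_div_four_le_cosh u
        nlinarith

/-- `∫ cosh(u)^j e^{-t cosh u} cos(nu) du`; up to a factor `±2`, the `j`-th derivative of the
Macdonald function `K_{in}`. -/
noncomputable def macdonaldMoment (n : ℝ) (j : ℕ) (t : ℝ) : ℝ :=
  ∫ u : ℝ, Real.cosh u ^ j * Real.exp (-t * Real.cosh u) * Real.cos (n * u)

theorem integrable_macdonaldMoment (n : ℝ) (j : ℕ) {t : ℝ} (ht : 0 < t) :
    Integrable fun u : ℝ => Real.cosh u ^ j * Real.exp (-t * Real.cosh u) * Real.cos (n * u) := by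
  refine (integrable_cosh_pow_mul_exp j ht).mono' (Continuous.aestronglyMeasurable (by fun_prop))
    (Eventually.of_forall fun u => ?_)
  have hc := Real.cosh_pos u
  rw [norm_mul, Real.norm_of_nonneg (by positivity)]
  exact mul_le_of_le_one_right (by positivity) (Real.abs_cos_le_one _)

theorem hasDerivAt_macdonaldMoment (n : ℝ) (j : ℕ) {t : ℝ} (ht : 0 < t) :
    HasDerivAt (macdonaldMoment n j) (-macdonaldMoment n (j + 1) t) t := by
  have h := (hasDerivAt_integral_of_dominated_loc_of_deriv_le (μ := volume) (s := Ioi (t / 2))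
    (F := fun t u => Real.cosh u ^ j * Real.exp (-t * Real.cosh u) * Real.cos (n * u))
    (F' := fun t u => -(Real.cosh u ^ (j + 1) * Real.exp (-t * Real.cosh u) * Real.cos (n * u)))
    (bound := fun u => Real.cosh u ^ (j + 1) * Real.exp (-(t / 2) * Real.cosh u)) (x₀ := t)
    (Ioi_mem_nhds (by linarith))
    (Eventually.of_forall fun x => Continuous.aestronglyMeasurable (by fun_prop))
    (integrable_macdonaldMoment n j ht) (Continuous.aestronglyMeasurable (by fun_prop))
    (Eventually.of_forall fun u x hx => ?_) (integrable_cosh_pow_mul_exp (j + 1) (by linarith))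
    (Eventually.of_forall fun u x hx => ?_)).2
  · rw [integral_neg] at h
    exact h
  · have hc := Real.cosh_pos u
    rw [norm_neg, norm_mul, Real.norm_of_nonneg (by positivity)]
    refine (mul_le_of_le_one_right (by positivity) (Real.abs_cos_le_one _)).trans ?_
    gcongr
    exact le_of_lt hx
  · have h1 : HasDerivAt (fun x : ℝ => Real.exp (-x * Real.cosh u))
        (Real.exp (-x * Real.cosh u) * (-1 * Real.cosh u)) x :=
      (((hasDerivAt_id x).neg).mul_const _).exp
    refine ((h1.const_mul (Real.cosh u ^ j)).mul_const (Real.cos (n * u))).congr_deriv ?_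
    ring

theorem abs_macdonaldMoment_le (n : ℝ) (j : ℕ) {t : ℝ} (ht : 1 ≤ t) :
    |macdonaldMoment n j t| ≤
      (∫ u : ℝ, Real.cosh u ^ j * Real.exp (-1 * Real.cosh u)) * Real.exp (-(t - 1)) := by
  rw [← integral_mul_const]
  rw [macdonaldMoment, ← Real.norm_eq_abs]
  refine norm_integral_le_of_norm_le ((integrable_cosh_pow_mul_exp j one_pos).mul_const _)
    (Eventually.of_forall fun u => ?_)
  have hc := Real.cosh_pos u
  rw [norm_mul, Real.norm_of_nonneg (by positivity)]
  refine (mul_le_of_le_one_right (by positivity) (Real.abs_cos_le_one _)).trans ?_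
  rw [mul_assoc, ← Real.exp_add]
  gcongr
  nlinarith [Real.one_le_cosh u]

theorem hasDerivAt_exp_neg_mul_cosh (t u : ℝ) :
    HasDerivAt (fun u => Real.exp (-t * Real.cosh u))
      (-t * Real.sinh u * Real.exp (-t * Real.cosh u)) u := by
  refine (((Real.hasDerivAt_cosh u).const_mul (-t)).exp).congr_deriv ?_
  ring

theorem integrable_mul_of_abs_le_cosh_pow (j : ℕ) {t C : ℝ} (ht : 0 < t) {f : ℝ → ℝ} (hf : Continuous f)
    (hC : ∀ u, |f u| ≤ C * Real.cosh u ^ j) :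
    Integrable fun u : ℝ => f u * Real.exp (-t * Real.cosh u) := by
  refine ((integrable_cosh_pow_mul_exp j ht).const_mul C).mono'
    (Continuous.aestronglyMeasurable (by fun_prop)) (Eventually.of_forall fun u => ?_)
  rw [norm_mul, Real.norm_of_nonneg (Real.exp_pos _).le, ← mul_assoc]
  gcongr
  exact hC u

theorem Real.abs_sinh_le_cosh (u : ℝ) : |Real.sinh u| ≤ Real.cosh u := by
  rw [abs_le]
  constructor
  · have := Real.exp_pos u
    rw [← Real.cosh_add_sinh] at this
    linarith
  · exact (Real.sinh_lt_cosh u).le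

/-- Bessel's modified equation for `K_{in}`, in terms of moments. -/
theorem macdonaldMoment_ode (n : ℝ) {t : ℝ} (ht : 0 < t) :
    t ^ 2 * macdonaldMoment n 2 t - t * macdonaldMoment n 1 t =
      (t ^ 2 - n ^ 2) * macdonaldMoment n 0 t := by
  have h0 := integrable_macdonaldMoment n 0 ht
  have h1 := integrable_macdonaldMoment n 1 ht
  have h2 := integrable_macdonaldMoment n 2 ht
  have hz : ∫ u : ℝ, ((t ^ 2 * (Real.cosh u ^ 2 * Real.exp (-t * Real.cosh u) * Real.cos (n * u)) -
      t * (Real.cosh u ^ 1 * Real.exp (-t * Real.cosh u) * Real.cos (n * u))) -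
      (t ^ 2 - n ^ 2) * (Real.cosh u ^ 0 * Real.exp (-t * Real.cosh u) * Real.cos (n * u))) = 0 := by
    -- The combination of the three integrands is an exact `u`-derivative of the integrable
    -- primitive below.
    refine integral_eq_zero_of_hasDerivAt_of_integrable
      (f := fun u => (-t * Real.sinh u * Real.cos (n * u) + n * Real.sin (n * u)) *
        Real.exp (-t * Real.cosh u)) (fun u => ?_)
      (((h2.const_mul _).sub (h1.const_mul _)).sub (h0.const_mul _)) ?_
    · have hl : HasDerivAt (fun u : ℝ => n * u) n u := by
        simpa using (hasDerivAt_id u).const_mul n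
      refine (((((Real.hasDerivAt_sinh u).const_mul (-t)).mul hl.cos).add
        (hl.sin.const_mul n)).mul (hasDerivAt_exp_neg_mul_cosh t u)).congr_deriv ?_
      simp only [Pi.add_apply, Pi.mul_apply]
      have := Real.cosh_sq u
      linear_combination (-t ^ 2 * Real.exp (-t * Real.cosh u) * Real.cos (n * u)) * this
    · refine integrable_mul_of_abs_le_cosh_pow 1 (C := t + |n|) ht (by fun_prop) fun u => ?_
      refine (abs_add_le _ _).trans ?_
      rw [abs_mul, abs_mul, abs_mul, abs_neg, abs_of_pos ht, pow_one]
      have e1 := Real.abs_sinh_le_cosh u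
      have e2 := Real.abs_cos_le_one (n * u)
      have e3 := Real.abs_sin_le_one (n * u)
      have e4 := Real.one_le_cosh u
      calc _ ≤ t * Real.cosh u * 1 + |n| * 1 := by gcongr
        _ ≤ _ := by nlinarith [abs_nonneg n]
  have h3 : Integrable fun u : ℝ =>
      t ^ 2 * (Real.cosh u ^ 2 * Real.exp (-t * Real.cosh u) * Real.cos (n * u)) -
      t * (Real.cosh u ^ 1 * Real.exp (-t * Real.cosh u) * Real.cos (n * u)) :=
    (h2.const_mul _).sub (h1.const_mul _)
  rw [integral_sub h3 (h0.const_mul _),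
    integral_sub (h2.const_mul _) (h1.const_mul _), integral_const_mul, integral_const_mul,
    integral_const_mul] at hz
  simp only [macdonaldMoment]
  linarith

/-- `K_{in}(e^s)`. -/
noncomputable def macdonald (n s : ℝ) : ℝ := macdonaldMoment n 0 (Real.exp s) / 2

/-- The derivative of `macdonald n`. -/
noncomputable def macdonaldDeriv (n s : ℝ) : ℝ := -(Real.exp s * macdonaldMoment n 1 (Real.exp s)) / 2

theorem hasDerivAt_macdonald (n s : ℝ) : HasDerivAt (macdonald n) (macdonaldDeriv n s) s := by
  have h := ((hasDerivAt_macdonaldMoment n 0 (Real.exp_pos s)).comp s (Real.hasDerivAt_exp s)).div_const 2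
  refine h.congr_deriv ?_
  simp only [macdonaldDeriv, zero_add]
  ring

/-- In the variable `s = log t` the modified Bessel equation loses its first-order term, which makes
an energy available. -/
theorem hasDerivAt_macdonaldDeriv (n s : ℝ) :
    HasDerivAt (macdonaldDeriv n) ((Real.exp (2 * s) - n ^ 2) * macdonald n s) s := by
  have h := ((Real.hasDerivAt_exp s).mul
    ((hasDerivAt_macdonaldMoment n 1 (Real.exp_pos s)).comp s (Real.hasDerivAt_exp s))).neg.div_const 2
  refine h.congr_deriv ?_
  have h2 := macdonaldMoment_ode n (Real.exp_pos s)
  rw [show 2 * s = s + s by ring, Real.exp_add]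
  simp only [macdonald, Function.comp]
  linear_combination h2 / 2

theorem continuous_macdonald (n : ℝ) : Continuous (macdonald n) :=
  continuous_iff_continuousAt.2 fun s => (hasDerivAt_macdonald n s).continuousAt

/-! ### Oscillation of `K_{in}(e^s)` as `s → -∞`. -/

/-- A form of the integral whose integrand has a limit as `s → -∞`. -/
theorem macdonald_eq_integral {n : ℝ} (hn : n ≠ 0) (s : ℝ) :
    macdonald n s = (∫ v : ℝ, Real.exp v * Real.exp (-Real.exp v) *
      Real.exp (-(Real.exp (2 * s - v) / 4)) * Real.sin (n * (v - s + Real.log 2))) / n := by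
  set t := Real.exp s with ht'
  have ht : 0 < t := Real.exp_pos s
  have hcos := integrable_macdonaldMoment n 0 ht
  have hsinh : Integrable fun u : ℝ =>
      (Real.sinh u * Real.sin (n * u)) * Real.exp (-t * Real.cosh u) := by
    refine integrable_mul_of_abs_le_cosh_pow 1 (C := 1) ht (by fun_prop) fun u => ?_
    rw [abs_mul, pow_one, one_mul]
    exact (mul_le_of_le_one_right (abs_nonneg _) (Real.abs_sin_le_one _)).trans
      (Real.abs_sinh_le_cosh u)
  have hcosh : Integrable fun u : ℝ =>
      (Real.cosh u * Real.sin (n * u)) * Real.exp (-t * Real.cosh u) := by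
    refine integrable_mul_of_abs_le_cosh_pow 1 (C := 1) ht (by fun_prop) fun u => ?_
    rw [abs_mul, pow_one, one_mul, abs_of_pos (Real.cosh_pos u)]
    exact mul_le_of_le_one_right (Real.cosh_pos u).le (Real.abs_sin_le_one _)
  have hodd : ∫ u : ℝ, (Real.cosh u * Real.sin (n * u)) * Real.exp (-t * Real.cosh u) = 0 := by
    have h := integral_neg_eq_self (fun u : ℝ => (Real.cosh u * Real.sin (n * u)) *
      Real.exp (-t * Real.cosh u)) volume
    simp only [Real.cosh_neg, mul_neg, Real.sin_neg, neg_mul, integral_neg] at h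
    simp only [neg_mul]
    linarith
  -- Integration by parts gains the factor `1 / n` and replaces `cos` by `sinh · sin`.
  have hparts : ∫ u : ℝ, (n * (Real.cosh u ^ 0 * Real.exp (-t * Real.cosh u) * Real.cos (n * u)) -
      t * ((Real.sinh u * Real.sin (n * u)) * Real.exp (-t * Real.cosh u))) = 0 := by
    refine integral_eq_zero_of_hasDerivAt_of_integrable
      (f := fun u => Real.sin (n * u) * Real.exp (-t * Real.cosh u)) (fun u => ?_)
      ((hcos.const_mul _).sub (hsinh.const_mul _)) ?_
    · have hl : HasDerivAt (fun u : ℝ => n * u) n u := by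
        simpa using (hasDerivAt_id u).const_mul n
      refine (hl.sin.mul (hasDerivAt_exp_neg_mul_cosh t u)).congr_deriv ?_
      ring
    · refine integrable_mul_of_abs_le_cosh_pow 0 (C := 1) ht (by fun_prop) fun u => ?_
      simpa using Real.abs_sin_le_one _
  rw [integral_sub (hcos.const_mul _) (hsinh.const_mul _), integral_const_mul,
    integral_const_mul] at hparts
  -- Adding the odd term `cosh · sin`, of integral zero, turns `sinh u` into `e^u`; then `e^v = t
  -- e^u / 2` is the new variable.
  have hshift : ∫ v : ℝ, Real.exp v * Real.exp (-Real.exp v) *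
      Real.exp (-(Real.exp (2 * s - v) / 4)) * Real.sin (n * (v - s + Real.log 2)) =
      ∫ u : ℝ, t / 2 * ((Real.cosh u * Real.sin (n * u)) * Real.exp (-t * Real.cosh u) +
        (Real.sinh u * Real.sin (n * u)) * Real.exp (-t * Real.cosh u)) := by
    rw [← integral_add_right_eq_self _ (s - Real.log 2)]
    refine integral_congr_ae (Eventually.of_forall fun u => ?_)
    simp only
    have e1 : Real.exp (u + (s - Real.log 2)) = t / 2 * Real.exp u := by
      rw [Real.exp_add, Real.exp_sub, Real.exp_log two_pos]; ring
    have e2 : Real.exp (2 * s - (u + (s - Real.log 2))) = t * 2 * Real.exp (-u) := by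
      rw [show 2 * s - (u + (s - Real.log 2)) = s + Real.log 2 + -u by ring, Real.exp_add,
        Real.exp_add, Real.exp_log two_pos]
    rw [e1, e2, show u + (s - Real.log 2) - s + Real.log 2 = u by ring, mul_assoc (t / 2 * Real.exp u),
      ← Real.exp_add, show -(t / 2 * Real.exp u) + -(t * 2 * Real.exp (-u) / 4) = -t * Real.cosh u by
        rw [Real.cosh_eq]; ring, ← Real.cosh_add_sinh u]
    ring
  rw [hshift, integral_const_mul, integral_add hcosh hsinh, hodd, zero_add, eq_div_iff hn, macdonald,
    macdonaldMoment]
  linarith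

/-- Two mean value steps on `[s, s + 1]`: `d'` is small at some `ξ` because it equals a difference
of values of `d`, and moving from `ξ` to `s` costs at most a value of `d''`. -/
theorem tendsto_deriv_atBot_zero {d d' d'' : ℝ → ℝ} (h1 : ∀ s, HasDerivAt d (d' s) s)
    (h2 : ∀ s, HasDerivAt d' (d'' s) s) (hd : Tendsto d atBot (𝓝 0))
    (hd'' : Tendsto d'' atBot (𝓝 0)) : Tendsto d' atBot (𝓝 0) := by
  rw [Metric.tendsto_nhds]
  intro ε hε
  have a1 := (Metric.tendsto_nhds.1 hd) (ε / 4) (by linarith)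
  have a2 := (Metric.tendsto_nhds.1 hd'') (ε / 4) (by linarith)
  obtain ⟨S, hS⟩ := eventually_atBot.1 (a1.and a2)
  simp only [dist_zero_right, Real.norm_eq_abs] at hS ⊢
  filter_upwards [eventually_le_atBot (S - 1)] with s hs
  obtain ⟨ξ, hξ, e1⟩ := exists_hasDerivAt_eq_slope d d' (show s < s + 1 by linarith)
    (fun x _ => (h1 x).continuousAt.continuousWithinAt) (fun x _ => h1 x)
  obtain ⟨η, hη, e2⟩ := exists_hasDerivAt_eq_slope d' d'' hξ.1
    (fun x _ => (h2 x).continuousAt.continuousWithinAt) (fun x _ => h2 x)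
  have b1 := abs_lt.1 (hS s (by linarith)).1
  have b2 := abs_lt.1 (hS (s + 1) (by linarith)).1
  have b3 := abs_lt.1 (hS η (by linarith [hξ.2, hη.2])).2
  have hpos : 0 < ξ - s := by linarith [hξ.1]
  rw [eq_div_iff hpos.ne'] at e2
  rw [add_sub_cancel_left, div_one] at e1
  have hle : ξ - s ≤ 1 := by linarith [hξ.2]
  rw [abs_lt]
  constructor <;> nlinarith

/-- The reflection formula together with `Γ(conj z) = conj Γ(z)`. This is where `sinh(πn)` enters
the estimate. -/
theorem normSq_Gamma_one_add_I_mul {n : ℝ} (hn : n ≠ 0) :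
    Complex.normSq (Complex.Gamma (1 + Complex.I * n)) = Real.pi * n / Real.sinh (Real.pi * n) := by
  have hI : Complex.I * n ≠ 0 := mul_ne_zero Complex.I_ne_zero (by exact_mod_cast hn)
  have hs : Complex.sinh (Real.pi * n) ≠ 0 := by
    rw [← Complex.ofReal_mul, ← Complex.ofReal_sinh]
    exact_mod_cast Real.sinh_ne_zero.2 (mul_ne_zero Real.pi_ne_zero hn)
  have h : (starRingEnd ℂ) (1 + Complex.I * n) = 1 - Complex.I * n := by
    simp [sub_eq_add_neg]
  have h3 := Complex.Gamma_mul_Gamma_one_sub (Complex.I * n)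
  rw [show (Real.pi : ℂ) * (Complex.I * n) = (Real.pi * n) * Complex.I by ring, Complex.sin_mul_I] at h3
  apply Complex.ofReal_injective
  rw [← Complex.mul_conj, ← Complex.Gamma_conj, h, add_comm 1 (Complex.I * (n : ℂ)),
    Complex.Gamma_add_one _ hI, mul_assoc, h3]
  push_cast
  field_simp

/-- The oscillation that `K_{in}(e^s)` approaches as `s → -∞` is `Im (macdonaldAmp n s) / n`. -/
noncomputable def macdonaldAmp (n s : ℝ) : ℂ :=
  Complex.Gamma (1 + Complex.I * n) * Complex.exp (Complex.I * n * (Real.log 2 - s))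

theorem normSq_macdonaldAmp {n : ℝ} (hn : n ≠ 0) (s : ℝ) :
    Complex.normSq (macdonaldAmp n s) = Real.pi * n / Real.sinh (Real.pi * n) := by
  rw [macdonaldAmp, map_mul, normSq_Gamma_one_add_I_mul hn, Complex.normSq_eq_norm_sq, Complex.norm_exp]
  simp [-Complex.ofNat_log]

theorem hasDerivAt_macdonaldAmp (n s : ℝ) :
    HasDerivAt (macdonaldAmp n) (-(Complex.I * n) * macdonaldAmp n s) s := by
  have h : HasDerivAt (fun s : ℝ => Complex.I * n * (Real.log 2 - s)) (Complex.I * n * (0 - 1)) s :=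
    ((hasDerivAt_const s (Real.log 2 : ℂ)).sub (Complex.ofRealCLM.hasDerivAt (x := s))).const_mul _
  refine ((h.cexp).const_mul _).congr_deriv ?_
  simp only [macdonaldAmp]
  ring

noncomputable def macdonaldLead (n s : ℝ) : ℝ := (macdonaldAmp n s).im / n

noncomputable def macdonaldLeadDeriv (n s : ℝ) : ℝ := -(macdonaldAmp n s).re

theorem hasDerivAt_macdonaldLead {n : ℝ} (hn : n ≠ 0) (s : ℝ) :
    HasDerivAt (macdonaldLead n) (macdonaldLeadDeriv n s) s := by
  have h := (Complex.imCLM.hasFDerivAt.comp_hasDerivAt s (hasDerivAt_macdonaldAmp n s)).div_const n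
  refine h.congr_deriv ?_
  simp [macdonaldLeadDeriv]
  field_simp

theorem hasDerivAt_macdonaldLeadDeriv {n : ℝ} (hn : n ≠ 0) (s : ℝ) :
    HasDerivAt (macdonaldLeadDeriv n) (-n ^ 2 * macdonaldLead n s) s := by
  have h := (Complex.reCLM.hasFDerivAt.comp_hasDerivAt s (hasDerivAt_macdonaldAmp n s)).neg
  refine h.congr_deriv ?_
  simp [macdonaldLead]
  field_simp

/-- The two terms are the squared real and imaginary parts of one complex oscillation of constant
modulus. -/
theorem macdonaldLead_energy {n : ℝ} (hn : n ≠ 0) (s : ℝ) :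
    macdonaldLeadDeriv n s ^ 2 + n ^ 2 * macdonaldLead n s ^ 2 =
      Real.pi * n / Real.sinh (Real.pi * n) := by
  rw [← normSq_macdonaldAmp hn s, Complex.normSq_apply, macdonaldLead, macdonaldLeadDeriv]
  field_simp

/-- Imaginary part of the integral for `Γ(1 + in)`. It is the integral in `macdonald_eq_integral`
without the factor that tends to `1`, which permits comparison by dominated convergence. -/
theorem macdonaldLead_eq_integral {n : ℝ} (s : ℝ) :
    macdonaldLead n s = (∫ v : ℝ, Real.exp v * Real.exp (-Real.exp v) *
      Real.sin (n * (v - s + Real.log 2))) / n := by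
  have hp : 0 < (1 + Complex.I * n).re := by simp
  obtain ⟨h1, h2⟩ := integrable_cexp_mul_sub_exp hp
  rw [macdonaldLead, macdonaldAmp, ← h2, ← integral_mul_const]
  have h3 := integral_im (h1.mul_const (Complex.exp (Complex.I * n * (Real.log 2 - s))))
  have h4 : ∀ z : ℂ, RCLike.im z = z.im := fun z => rfl
  rw [h4] at h3
  rw [← h3]
  congr 1
  refine integral_congr_ae (Eventually.of_forall fun v => ?_)
  simp only
  rw [h4, ← Complex.exp_add, Complex.exp_im, ← Real.exp_add]
  congr 2
  · simp [-Complex.ofNat_log, -Complex.ofReal_exp, sub_eq_add_neg]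
  · simp [-Complex.ofNat_log, -Complex.ofReal_exp]
    ring

theorem integrable_exp_mul_exp_neg_exp :
    Integrable fun v : ℝ => Real.exp v * Real.exp (-Real.exp v) := by
  have h := (integrable_cexp_mul_sub_exp (p := 1) (by simp)).1.norm
  refine h.congr (Eventually.of_forall fun v => ?_)
  simp only
  rw [Complex.norm_exp, ← Real.exp_add]
  simp [sub_eq_add_neg, Complex.exp_ofReal_re]

theorem abs_macdonald_le {n : ℝ} (hn : 0 < n) (s : ℝ) :
    |macdonald n s| ≤ (∫ v : ℝ, Real.exp v * Real.exp (-Real.exp v)) / n := by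
  rw [macdonald_eq_integral hn.ne', abs_div, abs_of_pos hn, ← Real.norm_eq_abs]
  gcongr
  refine norm_integral_le_of_norm_le integrable_exp_mul_exp_neg_exp (Eventually.of_forall fun v => ?_)
  rw [norm_mul, Real.norm_of_nonneg (by positivity)]
  refine (mul_le_of_le_one_right (by positivity) (Real.abs_sin_le_one _)).trans ?_
  refine mul_le_of_le_one_right (by positivity) ?_
  rw [Real.exp_le_one_iff]
  have := Real.exp_pos (2 * s - v)
  linarith

theorem abs_macdonaldLead_le {n : ℝ} (hn : 0 < n) (s : ℝ) :
    |macdonaldLead n s| ≤ (∫ v : ℝ, Real.exp v * Real.exp (-Real.exp v)) / n := by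
  rw [macdonaldLead_eq_integral, abs_div, abs_of_pos hn, ← Real.norm_eq_abs]
  gcongr
  refine norm_integral_le_of_norm_le integrable_exp_mul_exp_neg_exp (Eventually.of_forall fun v => ?_)
  rw [norm_mul, Real.norm_of_nonneg (by positivity)]
  exact mul_le_of_le_one_right (by positivity) (Real.abs_sin_le_one _)

theorem tendsto_exp_two_mul_sub_atBot (v : ℝ) :
    Tendsto (fun s : ℝ => Real.exp (2 * s - v)) atBot (𝓝 0) :=
  Real.tendsto_exp_atBot.comp (tendsto_atBot_add_const_right _ (-v)
    (tendsto_id.const_mul_atBot two_pos))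

theorem tendsto_exp_two_mul_atBot :
    Tendsto (fun s : ℝ => Real.exp (2 * s)) atBot (𝓝 0) := by
  simpa using tendsto_exp_two_mul_sub_atBot 0

theorem tendsto_macdonald_sub_lead {n : ℝ} (hn : 0 < n) :
    Tendsto (fun s => macdonald n s - macdonaldLead n s) atBot (𝓝 0) := by
  have hG := integrable_exp_mul_exp_neg_exp
  have hI : ∀ s : ℝ, Integrable fun v : ℝ => Real.exp v * Real.exp (-Real.exp v) *
      Real.exp (-(Real.exp (2 * s - v) / 4)) * Real.sin (n * (v - s + Real.log 2)) := by
    intro s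
    refine hG.mono' (Continuous.aestronglyMeasurable (by fun_prop)) (Eventually.of_forall fun v => ?_)
    rw [norm_mul, Real.norm_of_nonneg (by positivity)]
    refine (mul_le_of_le_one_right (by positivity) (Real.abs_sin_le_one _)).trans ?_
    refine mul_le_of_le_one_right (by positivity) ?_
    rw [Real.exp_le_one_iff]
    have := Real.exp_pos (2 * s - v)
    linarith
  have hJ : ∀ s : ℝ, Integrable fun v : ℝ => Real.exp v * Real.exp (-Real.exp v) *
      Real.sin (n * (v - s + Real.log 2)) := by
    intro s
    refine hG.mono' (Continuous.aestronglyMeasurable (by fun_prop)) (Eventually.of_forall fun v => ?_)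
    rw [norm_mul, Real.norm_of_nonneg (by positivity)]
    exact mul_le_of_le_one_right (by positivity) (Real.abs_sin_le_one _)
  have e : ∀ s, macdonald n s - macdonaldLead n s = (∫ v : ℝ, Real.exp v * Real.exp (-Real.exp v) *
      (Real.exp (-(Real.exp (2 * s - v) / 4)) - 1) * Real.sin (n * (v - s + Real.log 2))) / n := by
    intro s
    rw [macdonald_eq_integral hn.ne', macdonaldLead_eq_integral, ← sub_div, ← integral_sub (hI s) (hJ s)]
    congr 2
    ext v
    ring
  simp only [e]
  rw [show (0 : ℝ) = (∫ _ : ℝ, (0 : ℝ)) / n by simp]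
  refine Tendsto.div_const (tendsto_integral_filter_of_dominated_convergence _
    (Eventually.of_forall fun s => Continuous.aestronglyMeasurable (by fun_prop))
    (Eventually.of_forall fun s => Eventually.of_forall fun v => ?_) hG
    (Eventually.of_forall fun v => ?_)) n
  · have h1 := Real.exp_pos (2 * s - v)
    have h2 : Real.exp (-(Real.exp (2 * s - v) / 4)) ≤ 1 := by
      rw [Real.exp_le_one_iff]; linarith
    have h3 := Real.exp_pos (-(Real.exp (2 * s - v) / 4))
    rw [norm_mul]
    refine (mul_le_of_le_one_right (norm_nonneg _) (Real.abs_sin_le_one _)).trans ?_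
    rw [norm_mul, Real.norm_of_nonneg (by positivity)]
    refine mul_le_of_le_one_right (by positivity) ?_
    rw [Real.norm_eq_abs, abs_le]
    constructor <;> linarith
  · have h1 : Tendsto (fun s : ℝ => Real.exp v * Real.exp (-Real.exp v) *
      (Real.exp (-(Real.exp (2 * s - v) / 4)) - 1)) atBot
        (𝓝 (Real.exp v * Real.exp (-Real.exp v) * (Real.exp (-(0 / 4)) - 1))) :=
      (((((Real.continuous_exp.tendsto _).comp
        ((tendsto_exp_two_mul_sub_atBot v).div_const 4).neg)).sub_const 1).const_mul _)
    simp only [zero_div, neg_zero, Real.exp_zero, sub_self, mul_zero] at h1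
    -- The sine keeps oscillating as `s → -∞`, so only its boundedness is used.
    refine h1.zero_mul_isBoundedUnder_le (isBoundedUnder_of ⟨1, fun s => ?_⟩)
    exact Real.abs_sin_le_one _

/-! ### Energy estimates and the weighted `L¹` bound. -/

/-- The energy of the oscillator satisfied by `K_{in}(e^s)`. -/
noncomputable def macdonaldEnergy (n s : ℝ) : ℝ :=
  macdonaldDeriv n s ^ 2 + (n ^ 2 - Real.exp (2 * s)) * macdonald n s ^ 2

theorem hasDerivAt_exp_two_mul (s : ℝ) :
    HasDerivAt (fun s : ℝ => Real.exp (2 * s)) (2 * Real.exp (2 * s)) s := by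
  have h : HasDerivAt (fun s : ℝ => 2 * s) (2 * 1) s := (hasDerivAt_id s).const_mul 2
  refine h.exp.congr_deriv ?_
  ring

/-- By the equation for `K`, only the derivative of the coefficient `n² - e^{2s}` survives. -/
theorem hasDerivAt_macdonaldEnergy (n s : ℝ) :
    HasDerivAt (macdonaldEnergy n) (-(2 * (Real.exp (2 * s) * macdonald n s ^ 2))) s := by
  refine (((hasDerivAt_macdonaldDeriv n s).pow 2).add
    (((hasDerivAt_exp_two_mul s).const_sub (n ^ 2)).mul ((hasDerivAt_macdonald n s).pow 2))).congr_deriv ?_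
  simp only [Pi.pow_apply]
  push_cast
  ring

theorem tendsto_macdonaldDeriv_sub_lead {n : ℝ} (hn : 0 < n) :
    Tendsto (fun s => macdonaldDeriv n s - macdonaldLeadDeriv n s) atBot (𝓝 0) := by
  refine tendsto_deriv_atBot_zero (d'' := fun s => (Real.exp (2 * s) - n ^ 2) * macdonald n s -
    -n ^ 2 * macdonaldLead n s)
    (fun s => (hasDerivAt_macdonald n s).sub (hasDerivAt_macdonaldLead hn.ne' s))
    (fun s => (hasDerivAt_macdonaldDeriv n s).sub (hasDerivAt_macdonaldLeadDeriv hn.ne' s))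
    (tendsto_macdonald_sub_lead hn) ?_
  have h1 : Tendsto (fun s => Real.exp (2 * s) * macdonald n s) atBot (𝓝 0) :=
    tendsto_exp_two_mul_atBot.zero_mul_isBoundedUnder_le
      (isBoundedUnder_of ⟨_, fun s => abs_macdonald_le hn s⟩)
  have h2 := h1.sub ((tendsto_macdonald_sub_lead hn).const_mul (n ^ 2))
  rw [mul_zero, sub_zero] at h2
  refine h2.congr fun s => ?_
  ring

/-- `K` and `K'` differ from their bounded leading oscillations by `o(1)`, so the energy tends to
the constant energy of the oscillation. -/
theorem tendsto_macdonaldEnergy_atBot {n : ℝ} (hn : 0 < n) :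
    Tendsto (macdonaldEnergy n) atBot (𝓝 (Real.pi * n / Real.sinh (Real.pi * n))) := by
  have d0 := tendsto_macdonald_sub_lead hn
  have d1 := tendsto_macdonaldDeriv_sub_lead hn
  have b0 : IsBoundedUnder (· ≤ ·) atBot ((fun x => ‖x‖) ∘ macdonaldLead n) :=
    isBoundedUnder_of ⟨_, fun s => abs_macdonaldLead_le hn s⟩
  have b1 : IsBoundedUnder (· ≤ ·) atBot ((fun x => ‖x‖) ∘ macdonaldLeadDeriv n) := by
    refine isBoundedUnder_of ⟨Real.sqrt (Real.pi * n / Real.sinh (Real.pi * n)), fun s => ?_⟩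
    refine Real.abs_le_sqrt ?_
    rw [← macdonaldLead_energy hn.ne' s]
    nlinarith [sq_nonneg (n * macdonaldLead n s)]
  have h1 : Tendsto (fun s => Real.exp (2 * s) * macdonald n s ^ 2) atBot (𝓝 0) := by
    refine tendsto_exp_two_mul_atBot.zero_mul_isBoundedUnder_le
      (isBoundedUnder_of ⟨((∫ v : ℝ, Real.exp v * Real.exp (-Real.exp v)) / n) ^ 2, fun s => ?_⟩)
    simp only [Function.comp, norm_pow, Real.norm_eq_abs]
    exact pow_le_pow_left₀ (abs_nonneg _) (abs_macdonald_le hn s) 2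
  have h2 := ((((d1.pow 2).add ((d1.zero_mul_isBoundedUnder_le b1).const_mul 2)).add
    (((d0.pow 2).add ((d0.zero_mul_isBoundedUnder_le b0).const_mul 2)).const_mul (n ^ 2))).sub h1).const_add
    (Real.pi * n / Real.sinh (Real.pi * n))
  simp only [mul_zero, add_zero, sub_zero, ne_eq, OfNat.ofNat_ne_zero, not_false_eq_true, zero_pow] at h2
  refine h2.congr fun s => ?_
  rw [← macdonaldLead_energy hn.ne' s, macdonaldEnergy]
  ring

theorem tendsto_pow_mul_macdonaldMoment (n : ℝ) (i j : ℕ) :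
    Tendsto (fun t => t ^ i * macdonaldMoment n j t) atTop (𝓝 0) := by
  have h := ((Real.tendsto_pow_mul_exp_neg_atTop_nhds_zero i).const_mul
    ((∫ u : ℝ, Real.cosh u ^ j * Real.exp (-1 * Real.cosh u)) * Real.exp 1))
  rw [mul_zero] at h
  refine squeeze_zero_norm' ?_ h
  filter_upwards [eventually_ge_atTop 1] with t ht
  have h2 := abs_macdonaldMoment_le n j ht
  rw [norm_mul, norm_pow, Real.norm_of_nonneg (by linarith : (0 : ℝ) ≤ t), Real.norm_eq_abs]
  calc _ ≤ t ^ i * ((∫ u : ℝ, Real.cosh u ^ j * Real.exp (-1 * Real.cosh u)) * Real.exp (-(t - 1))) := by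
        gcongr
    _ = _ := by rw [show -(t - 1) = 1 + -t by ring, Real.exp_add]; ring

theorem tendsto_macdonaldEnergy_atTop (n : ℝ) :
    Tendsto (macdonaldEnergy n) atTop (𝓝 0) := by
  have h0 := tendsto_pow_mul_macdonaldMoment n 0 0
  have h1 := tendsto_pow_mul_macdonaldMoment n 1 0
  have h2 := tendsto_pow_mul_macdonaldMoment n 1 1
  have h := (((h2.pow 2).add ((h0.pow 2).const_mul (n ^ 2))).sub (h1.pow 2)).div_const 4
  simp only [mul_zero, add_zero, sub_zero, ne_eq, OfNat.ofNat_ne_zero, not_false_eq_true, zero_pow,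
    zero_div] at h
  refine (h.comp Real.tendsto_exp_atTop).congr fun s => ?_
  rw [macdonaldEnergy, macdonald, macdonaldDeriv, Function.comp, show 2 * s = s + s by ring, Real.exp_add]
  ring

theorem macdonaldEnergy_le {n : ℝ} (hn : 0 < n) (s : ℝ) :
    macdonaldEnergy n s ≤ Real.pi * n / Real.sinh (Real.pi * n) :=
  (antitone_of_hasDerivAt_nonpos (hasDerivAt_macdonaldEnergy n) fun s => by
    simp only [Pi.zero_apply, Left.neg_nonpos_iff]; positivity).ge_of_tendsto
    (tendsto_macdonaldEnergy_atBot hn) s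

/-- Here `n² - e^{2s} ≥ 3n²/4`, so the energy dominates `K²`. This gives `4π/3`; the constant is
rounded up to the square `9` for the later square root. -/
theorem macdonald_sq_le {n : ℝ} (hn : 0 < n) {s : ℝ} (hs : s ≤ Real.log (n / 2)) :
    Real.sinh (Real.pi * n) * macdonald n s ^ 2 ≤ 9 / n := by
  have hS : 0 < Real.sinh (Real.pi * n) := Real.sinh_pos_iff.2 (by positivity)
  have h := macdonaldEnergy_le hn s
  rw [macdonaldEnergy, le_div_iff₀ hS] at h
  have he : Real.exp (2 * s) ≤ n ^ 2 / 4 := by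
    rw [show 2 * s = s + s by ring, Real.exp_add]
    have : Real.exp s ≤ n / 2 := by
      rwa [← Real.le_log_iff_exp_le (by positivity)]
    nlinarith [Real.exp_pos s]
  rw [le_div_iff₀ hn]
  have hpi := Real.pi_le_four
  have h1 : n ^ 2 * (3 / 4) * macdonald n s ^ 2 * Real.sinh (Real.pi * n) ≤ Real.pi * n := by
    refine le_trans ?_ h
    gcongr
    nlinarith [sq_nonneg (macdonaldDeriv n s), sq_nonneg (macdonald n s)]
  have h2 : n * (Real.sinh (Real.pi * n) * macdonald n s ^ 2 * n) ≤ n * (4 / 3 * Real.pi) := by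
    linarith
  have h3 := le_of_mul_le_mul_left h2 hn
  linarith

/-- The integrand is `-E'/2`, so its integral is half the energy at `a`, the energy being `0` at
`+∞`. -/
theorem setIntegral_exp_mul_macdonald_sq {n : ℝ} (hn : 0 < n) (a : ℝ) :
    IntegrableOn (fun s => Real.exp (2 * s) * macdonald n s ^ 2) (Ioi a) ∧
    Real.sinh (Real.pi * n) * ∫ s in Ioi a, Real.exp (2 * s) * macdonald n s ^ 2 ≤ 2 * n := by
  have hS : 0 < Real.sinh (Real.pi * n) := Real.sinh_pos_iff.2 (by positivity)
  have hd : ∀ x ∈ Ici a, HasDerivAt (macdonaldEnergy n) (-(2 * (Real.exp (2 * x) * macdonald n x ^ 2))) x :=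
    fun x _ => hasDerivAt_macdonaldEnergy n x
  have hnp : ∀ x ∈ Ioi a, -(2 * (Real.exp (2 * x) * macdonald n x ^ 2)) ≤ 0 :=
    fun x _ => by simp only [Left.neg_nonpos_iff]; positivity
  have h1 := integrableOn_Ioi_deriv_of_nonpos' hd hnp (tendsto_macdonaldEnergy_atTop n)
  have h2 := integral_Ioi_of_hasDerivAt_of_nonpos' hd hnp (tendsto_macdonaldEnergy_atTop n)
  constructor
  · refine (h1.const_mul (-1 / 2)).congr (Eventually.of_forall fun x => ?_)
    simp only
    ring
  · rw [integral_neg, integral_const_mul] at h2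
    have h3 := macdonaldEnergy_le hn a
    rw [le_div_iff₀ hS] at h3
    have := Real.pi_le_four
    nlinarith

theorem exists_abs_le_of_isBoundedUnder {f : ℝ → ℝ} (hf : Continuous f)
    (h1 : IsBoundedUnder (· ≤ ·) atBot ((fun x => ‖x‖) ∘ f)) (h2 : Tendsto f atTop (𝓝 0)) :
    ∃ C, ∀ s, |f s| ≤ C := by
  obtain ⟨C1, hC1⟩ := h1
  obtain ⟨a, ha⟩ := eventually_atBot.1 (eventually_map.1 hC1)
  obtain ⟨b, hb⟩ := eventually_atTop.1 (Metric.tendsto_nhds.1 h2 1 one_pos)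
  obtain ⟨C2, hC2⟩ := (isCompact_Icc (a := a) (b := b)).exists_bound_of_continuousOn hf.continuousOn
  refine ⟨max C1 (max C2 1), fun s => ?_⟩
  rcases le_total s a with h | h
  · exact le_max_of_le_left (ha s h)
  rcases le_total b s with h' | h'
  · have := hb s h'
    rw [dist_zero_right] at this
    exact le_max_of_le_right (le_max_of_le_right this.le)
  · exact le_max_of_le_right (le_max_of_le_left (hC2 s ⟨h, h'⟩))

theorem continuous_macdonaldDeriv (n : ℝ) : Continuous (macdonaldDeriv n) :=
  continuous_iff_continuousAt.2 fun s => (hasDerivAt_macdonaldDeriv n s).continuousAt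

theorem exists_abs_macdonaldDeriv_le {n : ℝ} (hn : 0 < n) : ∃ C, ∀ s, |macdonaldDeriv n s| ≤ C := by
  refine exists_abs_le_of_isBoundedUnder (continuous_macdonaldDeriv n) ?_ ?_
  · refine isBoundedUnder_of_eventually_le (a := 1 + Real.sqrt (Real.pi * n / Real.sinh (Real.pi * n))) ?_
    filter_upwards [Metric.tendsto_nhds.1 (tendsto_macdonaldDeriv_sub_lead hn) 1 one_pos] with s hs
    rw [dist_zero_right] at hs
    have h1 : |macdonaldLeadDeriv n s| ≤ Real.sqrt (Real.pi * n / Real.sinh (Real.pi * n)) := by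
      refine Real.abs_le_sqrt ?_
      rw [← macdonaldLead_energy hn.ne' s]
      nlinarith [sq_nonneg (n * macdonaldLead n s)]
    calc ‖macdonaldDeriv n s‖ = ‖(macdonaldDeriv n s - macdonaldLeadDeriv n s) + macdonaldLeadDeriv n s‖ := by
          rw [sub_add_cancel]
      _ ≤ _ := (norm_add_le _ _).trans (add_le_add hs.le h1)
  · have h := ((tendsto_pow_mul_macdonaldMoment n 1 1).comp Real.tendsto_exp_atTop).neg.div_const 2
    rw [neg_zero, zero_div] at h
    refine h.congr fun s => ?_
    simp [macdonaldDeriv]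

theorem exists_exp_mul_abs_macdonald_le {n : ℝ} (hn : 0 < n) (i : ℕ) :
    ∃ C, ∀ s, Real.exp (i * s) * |macdonald n s| ≤ C := by
  have h : ∃ C, ∀ s, |Real.exp (i * s) * macdonald n s| ≤ C := by
    refine exists_abs_le_of_isBoundedUnder ?_ ?_ ?_
    · have := continuous_macdonald n
      fun_prop
    · refine isBoundedUnder_of_eventually_le
        (a := 1 * ((∫ v : ℝ, Real.exp v * Real.exp (-Real.exp v)) / n)) ?_
      filter_upwards [eventually_le_atBot 0] with s hs
      simp only [Function.comp, norm_mul, Real.norm_eq_abs, Real.abs_exp]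
      gcongr
      · rw [Real.exp_le_one_iff]
        exact mul_nonpos_of_nonneg_of_nonpos (by positivity) hs
      · exact abs_macdonald_le hn s
    · have h := ((tendsto_pow_mul_macdonaldMoment n i 0).comp Real.tendsto_exp_atTop).div_const 2
      rw [zero_div] at h
      refine h.congr fun s => ?_
      simp [macdonald, Real.exp_nat_mul, mul_div_assoc]
  simpa only [abs_mul, Real.abs_exp] using h

/-- The uniform weighted `L¹` bound for `K_{in}`. -/
theorem integral_exp_mul_abs_macdonald_le {n : ℝ} (hn : 1 ≤ n) :
    Integrable (fun v => Real.exp (v / 4) * |macdonald n v|) ∧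
      Real.sqrt (Real.sinh (Real.pi * n)) * ∫ v, Real.exp (v / 4) * |macdonald n v| ≤ 20 := by
  have hn0 : 0 < n := by linarith
  have hS : 0 < Real.sinh (Real.pi * n) := Real.sinh_pos_iff.2 (by positivity)
  set R := Real.sqrt (Real.sinh (Real.pi * n)) with hR
  have hR0 : 0 < R := Real.sqrt_pos.2 hS
  have hR2 : R ^ 2 = Real.sinh (Real.pi * n) := Real.sq_sqrt hS.le
  -- The cut lies below the turning point `log n`: the pointwise bound serves on the left, the
  -- integrated one on the right.
  set a := Real.log (n / 2) with ha
  have hcont := continuous_macdonald n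
  have i1 : IntegrableOn (fun v : ℝ => 3 / Real.sqrt n * Real.exp (1 / 4 * v)) (Iic a) :=
    (integrableOn_exp_mul_Iic (by norm_num) a).const_mul _
  have i2 : IntegrableOn (fun v : ℝ => n / 2 * Real.exp (-(3 / 2) * v) +
      R ^ 2 / (2 * n) * (Real.exp (2 * v) * macdonald n v ^ 2)) (Ioi a) :=
    ((integrableOn_exp_mul_Ioi (by norm_num) a).const_mul _).add
      ((setIntegral_exp_mul_macdonald_sq hn0 a).1.const_mul _)
  have b1 : ∀ v ∈ Iic a, R * (Real.exp (v / 4) * |macdonald n v|) ≤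
      3 / Real.sqrt n * Real.exp (1 / 4 * v) := by
    intro v hv
    have h := macdonald_sq_le hn0 (mem_Iic.1 hv)
    have h2 : R * |macdonald n v| ≤ 3 / Real.sqrt n := by
      refine le_of_sq_le_sq ?_ (by positivity)
      rw [mul_pow, div_pow, sq_abs, hR2, Real.sq_sqrt hn0.le]
      norm_num [h]
    rw [show v / 4 = 1 / 4 * v by ring, mul_left_comm, mul_comm]
    gcongr
  have b2 : ∀ v ∈ Ioi a, R * (Real.exp (v / 4) * |macdonald n v|) ≤
      n / 2 * Real.exp (-(3 / 2) * v) + R ^ 2 / (2 * n) * (Real.exp (2 * v) * macdonald n v ^ 2) := by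
    intro v _
    have e1 : Real.exp (-(3 / 2) * v) = Real.exp (-(3 / 4) * v) ^ 2 := by
      rw [← Real.exp_nat_mul]; ring_nf
    have e2 : Real.exp (2 * v) = Real.exp v ^ 2 := by
      rw [← Real.exp_nat_mul]; ring_nf
    have e3 : Real.exp (v / 4) = Real.exp (-(3 / 4) * v) * Real.exp v := by
      rw [← Real.exp_add]; ring_nf
    rw [e1, e2, e3, ← sq_abs (macdonald n v)]
    -- The inequality `2XY ≤ X² + Y²`, with `e^{v/4}` split as `e^{-3v/4} e^v` and the scale `n`
    -- chosen so that both resulting integrals are bounded uniformly in `n`.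
    have := sq_nonneg (n * Real.exp (-(3 / 4) * v) - R * Real.exp v * |macdonald n v|)
    have h3 : n / 2 * Real.exp (-(3 / 4) * v) ^ 2 +
        R ^ 2 / (2 * n) * (Real.exp v ^ 2 * |macdonald n v| ^ 2) -
        R * (Real.exp (-(3 / 4) * v) * Real.exp v * |macdonald n v|) =
        (n * Real.exp (-(3 / 4) * v) - R * Real.exp v * |macdonald n v|) ^ 2 / (2 * n) := by
      field_simp
      ring
    have h4 : 0 ≤ (n * Real.exp (-(3 / 4) * v) - R * Real.exp v * |macdonald n v|) ^ 2 / (2 * n) := by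
      positivity
    linarith
  have m : ∀ s : Set ℝ, AEStronglyMeasurable (fun v => R * (Real.exp (v / 4) * |macdonald n v|))
      (volume.restrict s) := fun s => Continuous.aestronglyMeasurable (by fun_prop)
  have nn : ∀ v, ‖R * (Real.exp (v / 4) * |macdonald n v|)‖ = R * (Real.exp (v / 4) * |macdonald n v|) :=
    fun v => Real.norm_of_nonneg (by positivity)
  have j1 : IntegrableOn (fun v => R * (Real.exp (v / 4) * |macdonald n v|)) (Iic a) :=
    i1.mono' (m _) ((ae_restrict_iff' measurableSet_Iic).2 (Eventually.of_forall fun v hv => by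
      rw [nn]; exact b1 v hv))
  have j2 : IntegrableOn (fun v => R * (Real.exp (v / 4) * |macdonald n v|)) (Ioi a) :=
    i2.mono' (m _) ((ae_restrict_iff' measurableSet_Ioi).2 (Eventually.of_forall fun v hv => by
      rw [nn]; exact b2 v hv))
  have j : Integrable (fun v => R * (Real.exp (v / 4) * |macdonald n v|)) := by
    rw [← integrableOn_univ, ← Iic_union_Ioi (a := a)]
    exact j1.union j2
  constructor
  · refine (j.const_mul R⁻¹).congr (Eventually.of_forall fun v => ?_)
    field_simp
  · rw [← integral_const_mul, ← intervalIntegral.integral_Iic_add_Ioi j1 j2]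
    have c1 := setIntegral_mono_on j1 i1 measurableSet_Iic b1
    have c2 := setIntegral_mono_on j2 i2 measurableSet_Ioi b2
    rw [integral_const_mul (3 / Real.sqrt n), integral_exp_mul_Iic (by norm_num)] at c1
    rw [integral_add ((integrableOn_exp_mul_Ioi (by norm_num) a).const_mul _)
      ((setIntegral_exp_mul_macdonald_sq hn0 a).1.const_mul _), integral_const_mul (n / 2),
      integral_const_mul (R ^ 2 / (2 * n)), integral_exp_mul_Ioi (by norm_num)] at c2
    have c3 := (setIntegral_exp_mul_macdonald_sq hn0 a).2
    rw [← hR2] at c3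
    have hea : Real.exp a = n / 2 := Real.exp_log (by positivity)
    have d1 : Real.exp (1 / 4 * a) ≤ Real.sqrt n := by
      refine le_of_pow_le_pow_left₀ (n := 4) (by norm_num) (by positivity) ?_
      rw [← Real.exp_nat_mul, show ((4 : ℕ) : ℝ) * (1 / 4 * a) = a by push_cast; ring, hea,
        show Real.sqrt n ^ 4 = (Real.sqrt n ^ 2) ^ 2 by ring, Real.sq_sqrt hn0.le]
      nlinarith
    have d2 : Real.exp (-(1 / 2) * a) ≤ 2 := by
      refine le_of_pow_le_pow_left₀ (n := 2) (by norm_num) (by positivity) ?_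
      rw [← Real.exp_nat_mul, show ((2 : ℕ) : ℝ) * (-(1 / 2) * a) = -a by push_cast; ring, Real.exp_neg,
        hea, inv_div, div_le_iff₀ hn0]
      linarith
    have d3 : n * Real.exp (-(3 / 2) * a) ≤ 4 := by
      rw [show -(3 / 2) * a = -a + -(1 / 2) * a by ring, Real.exp_add, Real.exp_neg, hea, inv_div,
        ← mul_assoc, mul_div_cancel₀ _ hn0.ne']
      linarith
    -- The left part contributes at most `12`, the tail at most `4/3 + 1`; together they stay below
    -- `20`.
    have f1 : 3 / Real.sqrt n * (Real.exp (1 / 4 * a) / (1 / 4)) ≤ 12 := by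
      have : 0 < Real.sqrt n := Real.sqrt_pos.2 hn0
      rw [div_mul_eq_mul_div, div_le_iff₀ this]
      linarith
    have f2 : R ^ 2 / (2 * n) * ∫ v in Ioi a, Real.exp (2 * v) * macdonald n v ^ 2 ≤ 1 := by
      rw [div_mul_eq_mul_div, div_le_iff₀ (by positivity)]
      linarith
    have f3 : n / 2 * (-Real.exp (-(3 / 2) * a) / -(3 / 2)) = n * Real.exp (-(3 / 2) * a) / 3 := by
      ring
    rw [f3] at c2
    linarith

/-! ### The Mellin transform of `K_{in}` and the integral behind the Lommel function. -/

/-- The Mellin transform of `K_{in}`. -/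
theorem integral_cexp_mul_macdonald {n : ℝ} {μ : ℂ} (hμ : μ.re < 1) :
    ∫ v : ℝ, Complex.exp ((1 - μ) * v) * (macdonald n v : ℂ) =
      (2 : ℂ) ^ (-μ - 1) * (Complex.Gamma ((1 - μ - Complex.I * n) / 2) *
        Complex.Gamma ((1 - μ + Complex.I * n) / 2)) := by
  have hp : 0 < ((1 - μ + Complex.I * n) / 2).re := by simp; linarith
  have hq : 0 < ((1 - μ - Complex.I * n) / 2).re := by simp; linarith
  -- The difference of the two Gamma arguments is `in`, so the `u`-integral is `2 K_{in}(2 e^{w/2})`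
  -- up to a factor free of `u`; the sine part is odd and drops out.
  have inner : ∀ w : ℝ, ∫ u : ℝ, Complex.exp (((1 - μ + Complex.I * n) / 2 + (1 - μ - Complex.I * n) / 2) * (w / 2) +
      ((1 - μ + Complex.I * n) / 2 - (1 - μ - Complex.I * n) / 2) * u -
      ((2 * Real.exp (w / 2) * Real.cosh u : ℝ) : ℂ)) =
      (fun r : ℝ => Complex.exp ((1 - μ) * (r - Real.log 2)) * (2 * (macdonald n r : ℂ))) (w / 2 + Real.log 2) := by
    intro w
    have het : Real.exp (w / 2 + Real.log 2) = 2 * Real.exp (w / 2) := by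
      rw [Real.exp_add, Real.exp_log two_pos, mul_comm]
    set t := Real.exp (w / 2 + Real.log 2) with ht
    have ht0 : 0 < t := Real.exp_pos _
    have hc := integrable_macdonaldMoment n 0 ht0
    have hs : Integrable fun u : ℝ => Real.sin (n * u) * Real.exp (-t * Real.cosh u) :=
      integrable_mul_of_abs_le_cosh_pow 0 (C := 1) ht0 (by fun_prop) fun u => by
        simpa using Real.abs_sin_le_one _
    have hs0 : ∫ u : ℝ, Real.sin (n * u) * Real.exp (-t * Real.cosh u) = 0 := by
      have h := integral_neg_eq_self (fun u : ℝ => Real.sin (n * u) * Real.exp (-t * Real.cosh u)) volume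
      simp only [Real.cosh_neg, mul_neg, Real.sin_neg, neg_mul, integral_neg] at h
      simp only [neg_mul]
      linarith
    have e : ∀ u : ℝ, Complex.exp (((1 - μ + Complex.I * n) / 2 + (1 - μ - Complex.I * n) / 2) * (w / 2) +
      ((1 - μ + Complex.I * n) / 2 - (1 - μ - Complex.I * n) / 2) * u -
      ((2 * Real.exp (w / 2) * Real.cosh u : ℝ) : ℂ)) = Complex.exp ((1 - μ) * (w / 2)) *
      (((Real.cosh u ^ 0 * Real.exp (-t * Real.cosh u) * Real.cos (n * u) : ℝ) : ℂ) +
        ((Real.sin (n * u) * Real.exp (-t * Real.cosh u) : ℝ) : ℂ) * Complex.I) := by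
      intro u
      rw [het]
      have : Complex.exp ((n * u : ℝ) * Complex.I) = ((Real.cos (n * u) : ℝ) : ℂ) + ((Real.sin (n * u) : ℝ) : ℂ) * Complex.I := by
        rw [Complex.exp_mul_I, Complex.ofReal_cos, Complex.ofReal_sin]
      have h2 : (((Real.cosh u ^ 0 * Real.exp (-(2 * Real.exp (w / 2)) * Real.cosh u) * Real.cos (n * u) : ℝ) : ℂ) +
        ((Real.sin (n * u) * Real.exp (-(2 * Real.exp (w / 2)) * Real.cosh u) : ℝ) : ℂ) * Complex.I) =
        ((Real.exp (-(2 * Real.exp (w / 2)) * Real.cosh u) : ℝ) : ℂ) * Complex.exp ((n * u : ℝ) * Complex.I) := by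
        rw [this]; push_cast; ring
      rw [h2, Complex.ofReal_exp, ← Complex.exp_add, ← Complex.exp_add]
      congr 1
      push_cast
      ring
    simp only [e]
    rw [integral_const_mul, integral_add hc.ofReal (hs.ofReal.mul_const _), integral_mul_const,
      integral_complex_ofReal, integral_complex_ofReal, hs0]
    change _ * (((macdonaldMoment n 0 t : ℝ) : ℂ) + _) = _
    simp only [macdonald, ← ht]
    push_cast
    ring_nf
  have h := Gamma_mul_Gamma_eq_integral hp hq
  simp only [inner] at h
  rw [Measure.integral_comp_div (fun x : ℝ => (fun r : ℝ => Complex.exp ((1 - μ) * (r - Real.log 2)) * (2 * (macdonald n r : ℂ))) (x + Real.log 2)) 2,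
    integral_add_right_eq_self (fun r : ℝ => Complex.exp ((1 - μ) * (r - Real.log 2)) * (2 * (macdonald n r : ℂ)))] at h
  have e2 : ∀ r : ℝ, Complex.exp ((1 - μ) * (r - Real.log 2)) * (2 * (macdonald n r : ℂ)) =
      (2 * Complex.exp (-(1 - μ) * Real.log 2)) * (Complex.exp ((1 - μ) * r) * (macdonald n r : ℂ)) := by
    intro r
    rw [show (1 - μ) * ((r : ℂ) - Real.log 2) = -(1 - μ) * Real.log 2 + (1 - μ) * r by ring, Complex.exp_add]
    ring
  simp only [e2] at h
  rw [integral_const_mul] at h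
  rw [mul_comm (Complex.Gamma ((1 - μ - Complex.I * n) / 2)), h,
    Complex.cpow_def_of_ne_zero two_ne_zero, show Complex.log 2 = (Real.log 2 : ℝ) by
      rw [Complex.ofReal_log two_pos.le]; simp]
  have e3 : Complex.exp ((Real.log 2 : ℝ) * (-μ - 1)) * Complex.exp (-(1 - μ) * (Real.log 2 : ℝ)) = 1 / 4 := by
    rw [← Complex.exp_add, show ((Real.log 2 : ℝ) : ℂ) * (-μ - 1) + -(1 - μ) * (Real.log 2 : ℝ) =
      ((-(2 : ℕ) * Real.log 2 : ℝ) : ℂ) by push_cast; ring, ← Complex.ofReal_exp, neg_mul, Real.exp_neg,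
      Real.exp_nat_mul, Real.exp_log two_pos]
    norm_num
  have : ∀ A B X : ℂ, A * ((|2| : ℝ) • (2 * B * X)) = 4 * (A * B) * X := by
    intro A B X
    rw [Complex.real_smul]; simp; ring
  rw [this, e3]
  simp

/-- `e^{-μv} / (2 cosh v)`. -/
noncomputable def sechKernel (μ : ℂ) (v : ℝ) : ℂ := Complex.exp (-μ * v) / ((2 * Real.cosh v : ℝ) : ℂ)

theorem continuous_sechKernel (μ : ℂ) : Continuous (sechKernel μ) := by
  unfold sechKernel
  refine Continuous.div (by fun_prop) (by fun_prop) fun v => ?_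
  have := Real.cosh_pos v
  exact_mod_cast (by positivity : 2 * Real.cosh v ≠ 0)

theorem norm_sechKernel (μ : ℂ) (v : ℝ) :
    ‖sechKernel μ v‖ = Real.exp (-μ.re * v) / (2 * Real.cosh v) := by
  have := Real.cosh_pos v
  rw [sechKernel, norm_div, Complex.norm_exp, Complex.norm_real, Real.norm_of_nonneg (by positivity)]
  simp

theorem integrable_sechKernel {μ : ℂ} (h1 : -1 < μ.re) (h2 : μ.re < 1) : Integrable (sechKernel μ) :=
  integrable_cexp_div_cosh h1 h2

/-- `e^{-μv} / (2 cosh v)` integrated against `K_{in}(e^{s+v})`; up to a Gamma factor this is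
the Lommel function `S_{μ,in}(e^s)`. -/
noncomputable def lommelIntegral (n : ℝ) (μ : ℂ) (s : ℝ) : ℂ :=
  ∫ v : ℝ, sechKernel μ v * (macdonald n (s + v) : ℂ)

/-- The range of `Re μ` is the one in which `e^{-Re μ v} / (2 cosh v) ≤ e^{v/4}` for all `v`: the
lower end governs `v ≥ 0`, the upper end `v ≤ 0`. -/
theorem norm_lommelIntegral_le {n : ℝ} (hn : 1 ≤ n) {μ : ℂ} (h1 : -5 / 4 ≤ μ.re) (h2 : μ.re ≤ 3 / 4)
    (s : ℝ) : Real.sqrt (Real.sinh (Real.pi * n)) * ‖lommelIntegral n μ s‖ ≤ 20 * Real.exp (-(s / 4)) := by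
  obtain ⟨hi, hb⟩ := integral_exp_mul_abs_macdonald_le hn
  have key : ‖lommelIntegral n μ s‖ ≤ Real.exp (-(s / 4)) * ∫ v, Real.exp (v / 4) * |macdonald n v| := by
    rw [← integral_add_left_eq_self _ s, ← integral_const_mul]
    refine norm_integral_le_of_norm_le ((hi.comp_add_left s).const_mul _) (Eventually.of_forall fun v => ?_)
    rw [norm_mul, norm_sechKernel, Complex.norm_real, Real.norm_eq_abs, ← mul_assoc, ← Real.exp_add]
    gcongr
    have hc := Real.cosh_pos v
    rw [div_le_iff₀ (by positivity), Real.cosh_eq, show -(s / 4) + (s + v) / 4 = v / 4 by ring,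
      mul_div_cancel₀ _ two_ne_zero, mul_add, ← Real.exp_add, ← Real.exp_add]
    rcases le_total 0 v with hv | hv
    · have : Real.exp (-μ.re * v) ≤ Real.exp (v / 4 + v) := by
        gcongr; nlinarith
      linarith [Real.exp_pos (v / 4 + -v)]
    · have : Real.exp (-μ.re * v) ≤ Real.exp (v / 4 + -v) := by
        gcongr; nlinarith
      linarith [Real.exp_pos (v / 4 + v)]
  calc _ ≤ Real.sqrt (Real.sinh (Real.pi * n)) *
        (Real.exp (-(s / 4)) * ∫ v, Real.exp (v / 4) * |macdonald n v|) := by gcongr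
    _ = (Real.sqrt (Real.sinh (Real.pi * n)) * ∫ v, Real.exp (v / 4) * |macdonald n v|) *
        Real.exp (-(s / 4)) := by ring
    _ ≤ _ := by gcongr

theorem integrable_sechKernel_mul {μ : ℂ} (h1 : -1 < μ.re) (h2 : μ.re < 1) {f : ℝ → ℝ} (hf : Continuous f)
    {C : ℝ} (hC : ∀ s, |f s| ≤ C) (s : ℝ) :
    Integrable fun v : ℝ => sechKernel μ v * (f (s + v) : ℂ) := by
  have hk := continuous_sechKernel μ
  refine ((integrable_sechKernel h1 h2).norm.mul_const C).mono'
    (Continuous.aestronglyMeasurable (by fun_prop)) (Eventually.of_forall fun v => ?_)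
  rw [norm_mul, Complex.norm_real, Real.norm_eq_abs]
  gcongr
  exact hC _

theorem hasDerivAt_integral_sechKernel_mul {μ : ℂ} (h1 : -1 < μ.re) (h2 : μ.re < 1) {f f' : ℝ → ℝ}
    (hf' : Continuous f') (hd : ∀ s, HasDerivAt f (f' s) s) {C C' : ℝ} (hC : ∀ s, |f s| ≤ C)
    (hC' : ∀ s, |f' s| ≤ C') (s : ℝ) :
    HasDerivAt (fun s => ∫ v : ℝ, sechKernel μ v * (f (s + v) : ℂ))
      (∫ v : ℝ, sechKernel μ v * (f' (s + v) : ℂ)) s := by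
  have hk := continuous_sechKernel μ
  have hf : Continuous f := continuous_iff_continuousAt.2 fun s => (hd s).continuousAt
  refine (hasDerivAt_integral_of_dominated_loc_of_deriv_le (μ := volume) (s := univ)
    (F := fun s v => sechKernel μ v * (f (s + v) : ℂ))
    (F' := fun s v => sechKernel μ v * (f' (s + v) : ℂ)) (bound := fun v => ‖sechKernel μ v‖ * C')
    univ_mem (Eventually.of_forall fun x => Continuous.aestronglyMeasurable (by fun_prop))
    (integrable_sechKernel_mul h1 h2 hf hC s) (Continuous.aestronglyMeasurable (by fun_prop))
    (Eventually.of_forall fun v x _ => ?_) ((integrable_sechKernel h1 h2).norm.mul_const C')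
    (Eventually.of_forall fun v x _ => ?_)).2
  · rw [norm_mul, Complex.norm_real, Real.norm_eq_abs]
    gcongr
    exact hC' _
  · exact (((hd (x + v)).comp_add_const x v).ofReal_comp).const_mul _

/-- Write `e^{2(s+v)} - n² = -(n² + e^{2s}) + e^{2s}(1 + e^{2v})`. The first part changes the
modified Bessel operator into the ordinary one; in the second, `1 + e^{2v} = 2 e^v cosh v` cancels
the denominator of the kernel and leaves the Mellin transform as source. -/
theorem lommelIntegral_ode {n : ℝ} (hn : 0 < n) {μ : ℂ} (h1 : -1 < μ.re) (h2 : μ.re < 1) :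
    ∃ F1 : ℝ → ℂ, (∀ s, HasDerivAt (lommelIntegral n μ) (F1 s) s) ∧
      ∀ s : ℝ, HasDerivAt F1 (-(n ^ 2 + Complex.exp (2 * s)) * lommelIntegral n μ s +
        Complex.exp ((μ + 1) * s) * ((2 : ℂ) ^ (-μ - 1) * (Complex.Gamma ((1 - μ - Complex.I * n) / 2) *
        Complex.Gamma ((1 - μ + Complex.I * n) / 2)))) s := by
  obtain ⟨C0, hC0⟩ := exists_exp_mul_abs_macdonald_le hn 0
  simp only [Nat.cast_zero, zero_mul, Real.exp_zero, one_mul] at hC0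
  obtain ⟨C1, hC1⟩ := exists_abs_macdonaldDeriv_le hn
  obtain ⟨C2, hC2⟩ := exists_exp_mul_abs_macdonald_le hn 2
  have hC3 : ∀ s, |(Real.exp (2 * s) - n ^ 2) * macdonald n s| ≤ C2 + n ^ 2 * C0 := by
    intro s
    rw [sub_mul]
    refine (abs_sub _ _).trans ?_
    rw [abs_mul, abs_mul, Real.abs_exp, abs_of_pos (by positivity : 0 < n ^ 2)]
    have := hC2 s
    push_cast at this
    gcongr
    exact hC0 s
  have hk := continuous_macdonald n
  have hk' := continuous_macdonaldDeriv n
  refine ⟨fun s => ∫ v : ℝ, sechKernel μ v * (macdonaldDeriv n (s + v) : ℂ), fun s =>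
    hasDerivAt_integral_sechKernel_mul h1 h2 hk' (hasDerivAt_macdonald n) hC0 hC1 s, fun s => ?_⟩
  refine (hasDerivAt_integral_sechKernel_mul h1 h2 (by fun_prop) (hasDerivAt_macdonaldDeriv n) hC1
    hC3 s).congr_deriv ?_
  have hM := integral_cexp_mul_macdonald (n := n) h2
  have hp : 0 < ((1 - μ + Complex.I * n) / 2).re := by simp; linarith
  have hq : 0 < ((1 - μ - Complex.I * n) / 2).re := by simp; linarith
  have hI : Integrable fun v : ℝ => Complex.exp ((1 - μ) * v) * (macdonald n v : ℂ) := by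
    by_contra hcon
    rw [integral_undef hcon] at hM
    have := mul_ne_zero (Complex.Gamma_ne_zero_of_re_pos hq) (Complex.Gamma_ne_zero_of_re_pos hp)
    have h2 : (2 : ℂ) ^ (-μ - 1) ≠ 0 := by simp [Complex.cpow_eq_zero_iff]
    exact mul_ne_zero h2 this hM.symm
  have e : ∀ v : ℝ, sechKernel μ v * (((Real.exp (2 * (s + v)) - n ^ 2) * macdonald n (s + v) : ℝ) : ℂ) =
      -(n ^ 2 + Complex.exp (2 * s)) * (sechKernel μ v * (macdonald n (s + v) : ℂ)) +
      Complex.exp ((μ + 1) * s) * (Complex.exp ((1 - μ) * ((s + v : ℝ) : ℂ)) * (macdonald n (s + v) : ℂ)) := by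
    intro v
    have hne : ((2 * Real.cosh v : ℝ) : ℂ) ≠ 0 := by
      have := Real.cosh_pos v
      exact_mod_cast (by positivity : 2 * Real.cosh v ≠ 0)
    have hcosh : ((2 * Real.cosh v : ℝ) : ℂ) = Complex.exp v + Complex.exp (-v) := by
      rw [Real.cosh_eq, mul_div_cancel₀ _ two_ne_zero]; push_cast; rfl
    have e1 : Complex.exp ((μ + 1) * s) * Complex.exp ((1 - μ) * ((s + v : ℝ) : ℂ)) =
        Complex.exp (2 * s) * (1 + Complex.exp (2 * v)) * sechKernel μ v := by
      rw [sechKernel, mul_div_assoc', eq_div_iff hne, hcosh, ← Complex.exp_add, mul_add, mul_add, add_mul,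
        ← Complex.exp_add, ← Complex.exp_add, mul_one, ← Complex.exp_add, add_mul (Complex.exp _),
        ← Complex.exp_add, ← Complex.exp_add]
      push_cast
      ring_nf
    rw [← mul_assoc (Complex.exp ((μ + 1) * s)), e1]
    push_cast
    rw [mul_add 2 (s : ℂ), Complex.exp_add]
    ring
  simp only [e]
  rw [integral_add ((integrable_sechKernel_mul h1 h2 hk hC0 s).const_mul _)
    ((hI.comp_add_left s).const_mul _), integral_const_mul, integral_const_mul,
    integral_add_left_eq_self (fun v : ℝ => Complex.exp ((1 - μ) * v) * (macdonald n v : ℂ)) s, hM]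
  rfl

theorem macdonaldLead_ofReal {n : ℝ} (hn : n ≠ 0) (s : ℝ) :
    (macdonaldLead n s : ℂ) = 1 / 2 * (Complex.Gamma (Complex.I * n) *
      Complex.exp (Complex.I * n * (Real.log 2 - s)) +
      Complex.Gamma (-(Complex.I * n)) * Complex.exp (-(Complex.I * n) * (Real.log 2 - s))) := by
  have hI : Complex.I * n ≠ 0 := mul_ne_zero Complex.I_ne_zero (by exact_mod_cast hn)
  have hn' : (n : ℂ) ≠ 0 := by exact_mod_cast hn
  have hconj : (starRingEnd ℂ) (macdonaldAmp n s) = Complex.Gamma (1 + -(Complex.I * n)) *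
      Complex.exp (-(Complex.I * n) * (Real.log 2 - s)) := by
    rw [macdonaldAmp, map_mul, ← Complex.Gamma_conj, ← Complex.exp_conj]
    simp [-Complex.ofNat_log]
  rw [macdonaldLead, Complex.ofReal_div, Complex.im_eq_sub_conj, hconj, macdonaldAmp, add_comm (1 : ℂ),
    add_comm (1 : ℂ), Complex.Gamma_add_one _ hI, Complex.Gamma_add_one _ (neg_ne_zero.2 hI)]
  field_simp
  ring

/-- Each exponential in the oscillation merely shifts `μ` to `μ ± in` in the kernel, whose integral
is known. -/
theorem integral_sechKernel_mul_lead {n : ℝ} (hn : n ≠ 0) {μ : ℂ} (h1 : -1 < μ.re) (h2 : μ.re < 1) (s : ℝ) :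
    ∫ v : ℝ, sechKernel μ v * (macdonaldLead n (s + v) : ℂ) =
      1 / 4 * (Complex.Gamma (Complex.I * n) * Complex.exp (Complex.I * n * (Real.log 2 - s)) *
        (Complex.Gamma ((1 - (μ + Complex.I * n)) / 2) * Complex.Gamma ((1 + (μ + Complex.I * n)) / 2)) +
      Complex.Gamma (-(Complex.I * n)) * Complex.exp (-(Complex.I * n) * (Real.log 2 - s)) *
        (Complex.Gamma ((1 - (μ - Complex.I * n)) / 2) * Complex.Gamma ((1 + (μ - Complex.I * n)) / 2))) := by
  have a1 : -1 < (μ + Complex.I * n).re ∧ (μ + Complex.I * n).re < 1 := by simp [h1, h2]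
  have a2 : -1 < (μ - Complex.I * n).re ∧ (μ - Complex.I * n).re < 1 := by simp [h1, h2]
  have e : ∀ v : ℝ, sechKernel μ v * (macdonaldLead n (s + v) : ℂ) =
      1 / 2 * (Complex.Gamma (Complex.I * n) * Complex.exp (Complex.I * n * (Real.log 2 - s))) *
        sechKernel (μ + Complex.I * n) v +
      1 / 2 * (Complex.Gamma (-(Complex.I * n)) * Complex.exp (-(Complex.I * n) * (Real.log 2 - s))) *
        sechKernel (μ - Complex.I * n) v := by
    intro v
    rw [macdonaldLead_ofReal hn, sechKernel, sechKernel, sechKernel,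
      show -(μ + Complex.I * n) * (v : ℂ) = -μ * v + -(Complex.I * n * v) by ring,
      show -(μ - Complex.I * n) * (v : ℂ) = -μ * v + (Complex.I * n * v) by ring, Complex.exp_add, Complex.exp_add,
      show Complex.I * n * (Real.log 2 - ((s + v : ℝ) : ℂ)) = Complex.I * n * (Real.log 2 - s) + -(Complex.I * n * v) by
        push_cast; ring,
      show -(Complex.I * n) * (Real.log 2 - ((s + v : ℝ) : ℂ)) = -(Complex.I * n) * (Real.log 2 - s) + (Complex.I * n * v) by
        push_cast; ring, Complex.exp_add, Complex.exp_add]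
    ring
  simp only [e]
  rw [integral_add ((integrable_sechKernel a1.1 a1.2).const_mul _)
    ((integrable_sechKernel a2.1 a2.2).const_mul _), integral_const_mul, integral_const_mul]
  have b1 := integral_cexp_div_cosh a1.1 a1.2
  have b2 := integral_cexp_div_cosh a2.1 a2.2
  rw [show ∫ v : ℝ, sechKernel (μ + Complex.I * n) v = _ from b1,
    show ∫ v : ℝ, sechKernel (μ - Complex.I * n) v = _ from b2]
  ring

theorem tendsto_lommelIntegral_sub_lead {n : ℝ} (hn : 0 < n) {μ : ℂ} (h1 : -1 < μ.re) (h2 : μ.re < 1) :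
    Tendsto (fun s => lommelIntegral n μ s - ∫ v : ℝ, sechKernel μ v * (macdonaldLead n (s + v) : ℂ))
      atBot (𝓝 0) := by
  have hk := continuous_sechKernel μ
  have hm := continuous_macdonald n
  have hl : Continuous (macdonaldLead n) :=
    continuous_iff_continuousAt.2 fun s => (hasDerivAt_macdonaldLead hn.ne' s).continuousAt
  have e : ∀ s, lommelIntegral n μ s - ∫ v : ℝ, sechKernel μ v * (macdonaldLead n (s + v) : ℂ) =
      ∫ v : ℝ, sechKernel μ v * ((macdonald n (s + v) - macdonaldLead n (s + v) : ℝ) : ℂ) := by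
    intro s
    rw [lommelIntegral, ← integral_sub (integrable_sechKernel_mul h1 h2 hm (abs_macdonald_le hn) s)
      (integrable_sechKernel_mul h1 h2 hl (abs_macdonaldLead_le hn) s)]
    refine integral_congr_ae (Eventually.of_forall fun v => ?_)
    simp only
    push_cast
    ring
  simp only [e]
  rw [show (0 : ℂ) = ∫ _ : ℝ, (0 : ℂ) by simp]
  refine tendsto_integral_filter_of_dominated_convergence _
    (Eventually.of_forall fun s => Continuous.aestronglyMeasurable (by fun_prop))
    (Eventually.of_forall fun s => Eventually.of_forall fun v => ?_)
    ((integrable_sechKernel h1 h2).norm.mul_const ((∫ v : ℝ, Real.exp v * Real.exp (-Real.exp v)) / n +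
      (∫ v : ℝ, Real.exp v * Real.exp (-Real.exp v)) / n))
    (Eventually.of_forall fun v => ?_)
  · rw [norm_mul, Complex.norm_real, Real.norm_eq_abs]
    gcongr
    exact (abs_sub _ _).trans (add_le_add (abs_macdonald_le hn _) (abs_macdonaldLead_le hn _))
  · have h := ((tendsto_macdonald_sub_lead hn).comp (tendsto_atBot_add_const_right atBot v tendsto_id)).ofReal
    have h' := h.const_mul (sechKernel μ v)
    simpa using h'

/-! ### Frobenius series for `J_{±in}` and `s_{μ,in}`. -/

theorem norm_mul_cexp_le {α : ℂ} {d : ℕ → ℂ} {B X : ℝ}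
    (hd : ∀ k, ‖d k‖ ≤ B * (X ^ k / k.factorial)) {s R : ℝ} (hs : |s| ≤ R) (k : ℕ) :
    ‖d k * Complex.exp ((α + 2 * k) * s)‖ ≤
      B * Real.exp (|α.re| * R) * ((X * Real.exp (2 * R)) ^ k / k.factorial) := by
  have hB : 0 ≤ B * (X ^ k / k.factorial) := (norm_nonneg _).trans (hd k)
  rw [norm_mul, Complex.norm_exp]
  have h1 : ((α + 2 * k) * (s : ℂ)).re ≤ |α.re| * R + k * (2 * R) := by
    have e : ((α + 2 * k) * (s : ℂ)).re = α.re * s + 2 * k * s := by simp; ring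
    rw [e]
    have a1 : α.re * s ≤ |α.re| * R := (le_abs_self _).trans (by rw [abs_mul]; gcongr)
    have a2 : s ≤ R := (le_abs_self _).trans hs
    have a3 : 2 * (k : ℝ) * s ≤ 2 * k * R := by gcongr
    linarith
  calc _ ≤ B * (X ^ k / k.factorial) * Real.exp (|α.re| * R + k * (2 * R)) := by
        gcongr; exact hd k
    _ = _ := by rw [Real.exp_add, Real.exp_nat_mul, mul_pow]; ring

/-- The coefficient bound reproduces itself: since `k + 1 ≤ e^k`, the factor `α + 2k` only enlarges
`B` and `X`. Hence the lemma can be iterated for higher derivatives. -/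
theorem hasDerivAt_tsum_mul_cexp {α : ℂ} {d : ℕ → ℂ} {B X : ℝ}
    (hd : ∀ k, ‖d k‖ ≤ B * (X ^ k / k.factorial)) :
    (∀ k, ‖d k * (α + 2 * k)‖ ≤ B * (‖α‖ + 2) * ((X * Real.exp 1) ^ k / k.factorial)) ∧
    (∀ s : ℝ, Summable fun k => d k * Complex.exp ((α + 2 * k) * s)) ∧
    ∀ s : ℝ, HasDerivAt (fun s : ℝ => ∑' k, d k * Complex.exp ((α + 2 * k) * s))
      (∑' k, d k * (α + 2 * k) * Complex.exp ((α + 2 * k) * s)) s := by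
  have h1 : ∀ k, ‖d k * (α + 2 * k)‖ ≤ B * (‖α‖ + 2) * ((X * Real.exp 1) ^ k / k.factorial) := by
    intro k
    have hB : 0 ≤ B * (X ^ k / k.factorial) := (norm_nonneg _).trans (hd k)
    have hk : (k : ℝ) + 1 ≤ Real.exp k := Real.add_one_le_exp _
    have h2 : ‖α + 2 * (k : ℂ)‖ ≤ (‖α‖ + 2) * Real.exp k := by
      refine (norm_add_le _ _).trans ?_
      rw [norm_mul, Complex.norm_natCast, Complex.norm_ofNat]
      have := norm_nonneg α
      nlinarith [Nat.cast_nonneg (α := ℝ) k]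
    rw [norm_mul]
    calc _ ≤ B * (X ^ k / k.factorial) * ((‖α‖ + 2) * Real.exp k) := by gcongr; exact hd k
      _ = _ := by
        rw [mul_pow, ← Real.exp_nat_mul, mul_one]; ring
  have hsum : ∀ s : ℝ, Summable fun k => d k * Complex.exp ((α + 2 * k) * s) := fun s =>
    .of_norm_bounded ((Real.summable_pow_div_factorial _).mul_left _) (norm_mul_cexp_le hd le_rfl)
  refine ⟨h1, hsum, fun s => ?_⟩
  refine hasDerivAt_tsum_of_isPreconnected (t := Ioo (s - 1) (s + 1)) (y₀ := s)
    (g := fun k (s : ℝ) => d k * Complex.exp ((α + 2 * k) * s))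
    (g' := fun k (s : ℝ) => d k * (α + 2 * k) * Complex.exp ((α + 2 * k) * s))
    (u := fun k : ℕ => B * (‖α‖ + 2) * Real.exp (|α.re| * (|s| + 1)) *
      ((X * Real.exp 1 * Real.exp (2 * (|s| + 1))) ^ k / k.factorial))
    ((Real.summable_pow_div_factorial (X * Real.exp 1 * Real.exp (2 * (|s| + 1)))).mul_left
      (B * (‖α‖ + 2) * Real.exp (|α.re| * (|s| + 1)))) isOpen_Ioo isPreconnected_Ioo
    (fun k y _ => ?_) (fun k y hy => ?_) (by simp) (hsum s) (by simp)
  · have h : HasDerivAt (fun y : ℝ => (α + 2 * k) * (y : ℂ)) ((α + 2 * k) * 1) y :=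
      (Complex.ofRealCLM.hasDerivAt (x := y)).const_mul _
    refine (h.cexp.const_mul _).congr_deriv ?_
    ring
  · refine norm_mul_cexp_le h1 ?_ k
    rw [abs_le]
    have := neg_abs_le s
    have := le_abs_self s
    constructor <;> linarith [hy.1, hy.2]

/-- Both factors `z ± in` have the real part of `z`; the bound is uniform in `n`. -/
theorem sq_re_le_norm_sq_add_sq {n : ℝ} {z : ℂ} (hz : 0 ≤ z.re) : z.re ^ 2 ≤ ‖z ^ 2 + n ^ 2‖ := by
  have e : z ^ 2 + n ^ 2 = (z + Complex.I * n) * (z - Complex.I * n) := by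
    linear_combination ((n : ℂ) ^ 2) * Complex.I_sq
  have h1 := Complex.abs_re_le_norm (z + Complex.I * n)
  have h2 := Complex.abs_re_le_norm (z - Complex.I * n)
  simp only [Complex.add_re, Complex.sub_re, Complex.mul_re, Complex.I_re, Complex.I_im, Complex.ofReal_re,
    Complex.ofReal_im, zero_mul, mul_zero, sub_zero, add_zero, abs_of_nonneg hz] at h1 h2
  rw [e, norm_mul, sq]
  gcongr

/-- A Frobenius series `∑ c_k e^{(α+2k)s}` whose coefficients satisfy Bessel's recurrence. -/
theorem bessel_frobenius {n : ℝ} {α : ℂ} (hα : 0 ≤ α.re) {c : ℕ → ℂ}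
    (hc : ∀ k : ℕ, c (k + 1) * ((α + 2 * (k + 1 : ℕ)) ^ 2 + n ^ 2) = -c k) :
    (∃ w1 : ℝ → ℂ, (∀ s, HasDerivAt (fun s : ℝ => ∑' k, c k * Complex.exp ((α + 2 * k) * s)) (w1 s) s) ∧
      ∀ s : ℝ, HasDerivAt w1 (-(n ^ 2 + Complex.exp (2 * s)) * (∑' k, c k * Complex.exp ((α + 2 * k) * s)) +
        c 0 * (α ^ 2 + n ^ 2) * Complex.exp (α * s)) s) ∧
    Tendsto (fun s : ℝ => (∑' k, c k * Complex.exp ((α + 2 * k) * s)) - c 0 * Complex.exp (α * s))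
      atBot (𝓝 0) := by
  have hb : ∀ k, ‖c k‖ ≤ ‖c 0‖ * (1 ^ k / k.factorial) := by
    intro k
    induction k with
    | zero => simp
    | succ k ih =>
      have hre : (α + 2 * (k + 1 : ℕ)).re = α.re + 2 * (k + 1) := by simp
      have h1 := sq_re_le_norm_sq_add_sq (n := n) (z := α + 2 * (k + 1 : ℕ)) (by rw [hre]; positivity)
      rw [hre] at h1
      have h2 : (k : ℝ) + 1 ≤ ‖(α + 2 * (k + 1 : ℕ)) ^ 2 + n ^ 2‖ := by nlinarith
      have h3 : ‖c (k + 1)‖ * (k + 1) ≤ ‖c k‖ := by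
        rw [← norm_neg (c k), ← hc k, norm_mul]
        gcongr
      rw [one_pow] at ih ⊢
      rw [Nat.factorial_succ]
      push_cast
      rw [mul_one_div, le_div_iff₀ (by positivity)] at ih ⊢
      calc _ = ‖c (k + 1)‖ * (k + 1) * k.factorial := by ring
        _ ≤ ‖c k‖ * k.factorial := by gcongr
        _ ≤ _ := ih
  obtain ⟨b1, s0, d0⟩ := hasDerivAt_tsum_mul_cexp (α := α) hb
  obtain ⟨b2, s1, d1⟩ := hasDerivAt_tsum_mul_cexp (α := α) b1
  obtain ⟨b3, s2, d2⟩ := hasDerivAt_tsum_mul_cexp (α := α) b2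
  refine ⟨⟨_, d0, fun s => (d1 s).congr_deriv ?_⟩, ?_⟩
  · have h1 : Summable fun k : ℕ => c k * ((α + 2 * k) ^ 2 + n ^ 2) * Complex.exp ((α + 2 * k) * s) := by
      refine ((s2 s).add ((s0 s).mul_left (n ^ 2 : ℂ))).congr fun k => ?_
      ring
    have h2 : ∑' k : ℕ, c k * (α + 2 * k) * (α + 2 * k) * Complex.exp ((α + 2 * k) * s) =
        (∑' k : ℕ, c k * ((α + 2 * k) ^ 2 + n ^ 2) * Complex.exp ((α + 2 * k) * s)) -
          n ^ 2 * ∑' k : ℕ, c k * Complex.exp ((α + 2 * k) * s) := by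
      rw [← tsum_mul_left, ← h1.tsum_sub ((s0 s).mul_left _)]
      congr 1
      ext k
      ring
    -- The term `k = 0` is the source; the recurrence turns the others into `-e^{2s}` times the
    -- series itself.
    rw [h2, h1.tsum_eq_zero_add]
    have h3 : ∀ k : ℕ, c (k + 1) * ((α + 2 * (k + 1 : ℕ)) ^ 2 + n ^ 2) *
        Complex.exp ((α + 2 * (k + 1 : ℕ)) * s) =
        -Complex.exp (2 * s) * (c k * Complex.exp ((α + 2 * k) * s)) := by
      intro k
      rw [hc k, show (α + 2 * (k + 1 : ℕ)) * (s : ℂ) = 2 * s + (α + 2 * k) * s by push_cast; ring,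
        Complex.exp_add]
      ring
    simp only [h3]
    rw [tsum_mul_left]
    simp only [Nat.cast_zero, mul_zero, add_zero]
    ring
  · have e : ∀ s : ℝ, (∑' k, c k * Complex.exp ((α + 2 * k) * s)) - c 0 * Complex.exp (α * s) =
        ∑' k : ℕ, c (k + 1) * Complex.exp ((α + 2 * (k + 1 : ℕ)) * s) := by
      intro s
      rw [(s0 s).tsum_eq_zero_add]
      simp
    simp only [e]
    rw [show (0 : ℂ) = ∑' _ : ℕ, (0 : ℂ) by simp]
    have hn : ∀ (k : ℕ) (s : ℝ), ‖Complex.exp ((α + 2 * (k + 1 : ℕ)) * s)‖ =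
        Real.exp ((α.re + 2 * (k + 1)) * s) := by
      intro k s
      rw [Complex.norm_exp]
      simp
    refine tendsto_tsum_of_dominated_convergence (bound := fun k => ‖c 0‖ * (1 ^ (k + 1) / (k + 1).factorial))
      (((summable_nat_add_iff 1).2 (Real.summable_pow_div_factorial 1)).mul_left _) (fun k => ?_) ?_
    · rw [← mul_zero (c (k + 1))]
      refine Tendsto.const_mul _ (tendsto_zero_iff_norm_tendsto_zero.2 ?_)
      simp only [hn]
      exact Real.tendsto_exp_atBot.comp (tendsto_id.const_mul_atBot (by positivity))
    · filter_upwards [eventually_le_atBot 0] with s hs k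
      rw [norm_mul, hn]
      refine (mul_le_of_le_one_right (norm_nonneg _) ?_).trans (hb (k + 1))
      rw [Real.exp_le_one_iff]
      exact mul_nonpos_of_nonneg_of_nonpos (by positivity) hs

theorem ofReal_exp_div_two_cpow (ν : ℂ) (s : ℝ) :
    ((Real.exp s : ℂ) / 2) ^ ν = Complex.exp (-ν * Real.log 2) * Complex.exp (ν * s) := by
  have h : (Real.exp s : ℂ) / 2 = ((Real.exp (s - Real.log 2) : ℝ) : ℂ) := by
    rw [Real.exp_sub, Real.exp_log two_pos]; push_cast; rfl
  rw [h, Complex.cpow_def_of_ne_zero (by exact_mod_cast (Real.exp_pos _).ne'),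
    ← Complex.ofReal_log (Real.exp_pos _).le, Real.log_exp, ← Complex.exp_add]
  congr 1
  push_cast
  ring

theorem ofReal_exp_cpow (ν : ℂ) (s : ℝ) : (Real.exp s : ℂ) ^ ν = Complex.exp (ν * s) := by
  rw [Complex.cpow_def_of_ne_zero (by exact_mod_cast (Real.exp_pos _).ne'),
    ← Complex.ofReal_log (Real.exp_pos _).le, Real.log_exp, mul_comm]

theorem ofReal_exp_pow_two_mul (s : ℝ) (k : ℕ) : (Real.exp s : ℂ) ^ (2 * k) = Complex.exp (2 * k * s) := by
  rw [Complex.ofReal_exp, ← Complex.exp_nat_mul]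
  push_cast
  ring_nf

theorem besselJ_exp_eq {n : ℝ} {ν : ℂ} (hν : ν ^ 2 = -n ^ 2) (hre : ν.re = 0) :
    ∃ c : ℕ → ℂ, (∀ k : ℕ, c (k + 1) * ((ν + 2 * (k + 1 : ℕ)) ^ 2 + n ^ 2) = -c k) ∧
      c 0 = Complex.exp (-ν * Real.log 2) / Complex.Gamma (ν + 1) ∧
      ∀ s : ℝ, besselJ ν (Real.exp s) = ∑' k, c k * Complex.exp ((ν + 2 * k) * s) := by
  refine ⟨fun k => Complex.exp (-ν * Real.log 2) * ((-1 : ℂ) ^ k / 4 ^ k / (k.factorial * Complex.Gamma (ν + k + 1))),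
    fun k => ?_, by simp [div_eq_mul_inv], fun s => ?_⟩
  · beta_reduce
    have h0 : ν + k + 1 ≠ 0 := by
      intro h
      have := congrArg Complex.re h
      simp [hre] at this
      linarith [Nat.cast_nonneg (α := ℝ) k]
    have h1 : ν + ((k + 1 : ℕ) : ℂ) + 1 = (ν + k + 1) + 1 := by push_cast; ring
    have hG : Complex.Gamma (ν + k + 1) ≠ 0 := Complex.Gamma_ne_zero_of_re_pos (by simp [hre]; positivity)
    have hk : (k : ℂ) + 1 ≠ 0 := by exact_mod_cast k.succ_ne_zero
    have hk2 : (k.factorial : ℂ) ≠ 0 := by exact_mod_cast k.factorial_ne_zero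
    have h3 : (ν + 2 * ((k + 1 : ℕ) : ℂ)) ^ 2 + n ^ 2 = 4 * (k + 1) * (ν + k + 1) := by
      push_cast
      linear_combination hν
    rw [h3, h1, Complex.Gamma_add_one _ h0, Nat.factorial_succ, pow_succ, pow_succ]
    push_cast
    field_simp
  · rw [besselJ, ofReal_exp_div_two_cpow, ← tsum_mul_left]
    congr 1
    ext k
    rw [div_pow, ← pow_mul, ofReal_exp_pow_two_mul, add_mul, Complex.exp_add]
    ring

theorem lommels_exp_eq {n : ℝ} {μ : ℂ} (hμ : -1 < μ.re) :
    ∃ c : ℕ → ℂ, (∀ k : ℕ, c (k + 1) * ((μ + 1 + 2 * (k + 1 : ℕ)) ^ 2 + n ^ 2) = -c k) ∧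
      c 0 * ((μ + 1) ^ 2 + n ^ 2) = 1 ∧
      ∀ s : ℝ, lommels μ (Complex.I * n) (Real.exp s) = ∑' k, c k * Complex.exp ((μ + 1 + 2 * k) * s) := by
  have hI : (Complex.I * n) ^ 2 = -(n : ℂ) ^ 2 := by
    linear_combination ((n : ℂ) ^ 2) * Complex.I_sq
  have hne : ∀ k : ℕ, (μ + 1 + 2 * (k : ℂ)) ^ 2 + n ^ 2 ≠ 0 := by
    intro k h
    have hre : (μ + 1 + 2 * (k : ℂ)).re = μ.re + 1 + 2 * k := by simp
    have hpos : 0 < μ.re + 1 + 2 * k := by linarith [Nat.cast_nonneg (α := ℝ) k]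
    have h1 := sq_re_le_norm_sq_add_sq (n := n) (z := μ + 1 + 2 * (k : ℂ)) (by rw [hre]; exact hpos.le)
    rw [h, norm_zero, hre] at h1
    nlinarith
  refine ⟨fun k => (-1 : ℂ) ^ k / ∏ m ∈ Finset.Icc 1 (k + 1), ((μ + 2 * (m : ℂ) - 1) ^ 2 - (Complex.I * n) ^ 2),
    fun k => ?_, ?_, fun s => ?_⟩
  · beta_reduce
    rw [Finset.prod_Icc_succ_top (by omega : 1 ≤ k + 1 + 1), hI]
    have h1 : (μ + 2 * ((k + 1 + 1 : ℕ) : ℂ) - 1) ^ 2 - -(n : ℂ) ^ 2 = (μ + 1 + 2 * (k + 1 : ℕ)) ^ 2 + n ^ 2 := by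
      push_cast; ring
    rw [h1, div_mul_eq_mul_div, mul_div_mul_right _ _ (hne (k + 1)), pow_succ]
    ring
  · have h1 := hne 0
    simp only [Nat.cast_zero, mul_zero, add_zero] at h1
    simp only [pow_zero, zero_add, Finset.Icc_self, Finset.prod_singleton, hI, Nat.cast_one]
    rw [show (μ + 2 * 1 - 1) ^ 2 - -(n : ℂ) ^ 2 = (μ + 1) ^ 2 + n ^ 2 by ring, one_div, inv_mul_cancel₀ h1]
  · rw [lommels, ofReal_exp_cpow, ← tsum_mul_left]
    congr 1
    ext k
    rw [ofReal_exp_pow_two_mul, add_mul _ (2 * (k : ℂ)), Complex.exp_add]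
    ring

/-! ### Uniqueness for the Bessel equation with decay at `-∞`. -/

/-- A Grönwall argument: `Q = W'² + (n² + e^{2s}) W²` has `Q' = 2 e^{2s} W² ≤ (2 e^{2s} / n²) Q`, so
`Q exp(-e^{2s}/n²)` is non-increasing. It starts from `0` at `-∞`, hence vanishes. -/
theorem eq_zero_of_bessel_ode_real {n : ℝ} (hn : 0 < n) {W W1 : ℝ → ℝ} (h1 : ∀ s, HasDerivAt W (W1 s) s)
    (h2 : ∀ s, HasDerivAt W1 (-(n ^ 2 + Real.exp (2 * s)) * W s) s) (h0 : Tendsto W atBot (𝓝 0)) (s : ℝ) :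
    W s = 0 := by
  have hW1 : Tendsto W1 atBot (𝓝 0) := by
    refine tendsto_deriv_atBot_zero h1 h2 h0 ?_
    have h := ((tendsto_exp_two_mul_atBot.const_add (n ^ 2)).neg).mul h0
    rwa [mul_zero] at h
  have hd : ∀ s, HasDerivAt (fun s => (W1 s ^ 2 + (n ^ 2 + Real.exp (2 * s)) * W s ^ 2) *
      Real.exp (-(Real.exp (2 * s) / n ^ 2)))
      (-(2 * Real.exp (2 * s) / n ^ 2 * (W1 s ^ 2 + Real.exp (2 * s) * W s ^ 2)) *
        Real.exp (-(Real.exp (2 * s) / n ^ 2))) s := by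
    intro s
    refine ((((h2 s).pow 2).add (((hasDerivAt_exp_two_mul s).const_add (n ^ 2)).mul ((h1 s).pow 2))).mul
      ((hasDerivAt_exp_two_mul s).div_const (n ^ 2)).neg.exp).congr_deriv ?_
    simp only [Pi.add_apply, Pi.mul_apply, Pi.pow_apply, Pi.neg_apply]
    push_cast
    field_simp
    ring
  have hE : Tendsto (fun s => (W1 s ^ 2 + (n ^ 2 + Real.exp (2 * s)) * W s ^ 2) *
      Real.exp (-(Real.exp (2 * s) / n ^ 2))) atBot (𝓝 0) := by
    have h := ((hW1.pow 2).add ((tendsto_exp_two_mul_atBot.const_add (n ^ 2)).mul (h0.pow 2))).mul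
      ((Real.continuous_exp.tendsto _).comp (tendsto_exp_two_mul_atBot.div_const (n ^ 2)).neg)
    simpa using h
  have h3 := (antitone_of_hasDerivAt_nonpos hd fun s => by
    simp only [Pi.zero_apply, neg_mul, Left.neg_nonpos_iff]; positivity).ge_of_tendsto hE s
  have h4 : W1 s ^ 2 + (n ^ 2 + Real.exp (2 * s)) * W s ^ 2 ≤ 0 := by
    by_contra! hcon
    exact absurd h3 (not_le.2 (mul_pos hcon (Real.exp_pos _)))
  have h5 := Real.exp_pos (2 * s)
  have h6 : n ^ 2 * W s ^ 2 ≤ 0 := by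
    nlinarith [sq_nonneg (W1 s), mul_nonneg h5.le (sq_nonneg (W s))]
  have h7 : 0 < n ^ 2 := by positivity
  have h8 : W s ^ 2 ≤ 0 := by nlinarith
  exact pow_eq_zero_iff two_ne_zero |>.1 (le_antisymm h8 (sq_nonneg _))

theorem eq_zero_of_bessel_ode {n : ℝ} (hn : 0 < n) {W W1 : ℝ → ℂ} (h1 : ∀ s, HasDerivAt W (W1 s) s)
    (h2 : ∀ s : ℝ, HasDerivAt W1 (-(n ^ 2 + Complex.exp (2 * s)) * W s) s) (h0 : Tendsto W atBot (𝓝 0))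
    (s : ℝ) : W s = 0 := by
  have e : ∀ s : ℝ, -(n ^ 2 + Complex.exp (2 * s)) * W s =
      ((-(n ^ 2 + Real.exp (2 * s)) : ℝ) : ℂ) * W s := by
    intro s; push_cast; rfl
  simp only [e] at h2
  apply Complex.ext
  · refine eq_zero_of_bessel_ode_real hn (W := fun s => (W s).re) (W1 := fun s => (W1 s).re)
      (fun s => Complex.reCLM.hasFDerivAt.comp_hasDerivAt s (h1 s)) (fun s => ?_) ?_ s
    · refine (Complex.reCLM.hasFDerivAt.comp_hasDerivAt s (h2 s)).congr_deriv ?_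
      rw [Complex.reCLM_apply, Complex.re_ofReal_mul]
    · exact (Complex.continuous_re.tendsto 0).comp h0
  · refine eq_zero_of_bessel_ode_real hn (W := fun s => (W s).im) (W1 := fun s => (W1 s).im)
      (fun s => Complex.imCLM.hasFDerivAt.comp_hasDerivAt s (h1 s)) (fun s => ?_) ?_ s
    · refine (Complex.imCLM.hasFDerivAt.comp_hasDerivAt s (h2 s)).congr_deriv ?_
      rw [Complex.imCLM_apply, Complex.im_ofReal_mul]
    · exact (Complex.continuous_im.tendsto 0).comp h0

/-! ### Connection coefficients and the representation for `|Re μ| < 1`. -/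

theorem sin_pi_mul_I_mul_ne_zero {n : ℝ} (hn : n ≠ 0) : Complex.sin (Real.pi * (Complex.I * n)) ≠ 0 := by
  rw [show (Real.pi : ℂ) * (Complex.I * n) = ((Real.pi * n : ℝ) : ℂ) * Complex.I by push_cast; ring,
    Complex.sin_mul_I, ← Complex.ofReal_sinh]
  exact mul_ne_zero (by exact_mod_cast Real.sinh_ne_zero.2 (mul_ne_zero Real.pi_ne_zero hn)) Complex.I_ne_zero

theorem besselY_I_mul {n : ℝ} (hn : n ≠ 0) (z : ℂ) :
    besselY (Complex.I * n) z = besselYQuotient (Complex.I * n) z := by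
  rw [besselY, if_neg]
  rintro ⟨m, hm⟩
  have := congrArg Complex.im hm
  simp at this
  exact hn this

theorem sin_mul_besselJ_sub_cos_mul_besselY {n : ℝ} (hn : n ≠ 0) (μ z : ℂ) :
    Complex.sin ((μ - Complex.I * n) / 2 * Real.pi) * besselJ (Complex.I * n) z -
        Complex.cos ((μ - Complex.I * n) / 2 * Real.pi) * besselY (Complex.I * n) z =
      (-Complex.cos ((μ + Complex.I * n) / 2 * Real.pi) * besselJ (Complex.I * n) z +
        Complex.cos ((μ - Complex.I * n) / 2 * Real.pi) * besselJ (-(Complex.I * n)) z) /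
        Complex.sin (Real.pi * (Complex.I * n)) := by
  have hs := sin_pi_mul_I_mul_ne_zero hn
  rw [besselY_I_mul hn, besselYQuotient,
    show (μ + Complex.I * n) / 2 * Real.pi = (μ - Complex.I * n) / 2 * Real.pi + Real.pi * (Complex.I * n) by ring,
    Complex.cos_add]
  generalize Complex.sin (Real.pi * (Complex.I * n)) = S at *
  generalize Complex.cos (Real.pi * (Complex.I * n)) = T
  generalize Complex.sin ((μ - Complex.I * n) / 2 * Real.pi) = P
  generalize Complex.cos ((μ - Complex.I * n) / 2 * Real.pi) = Q
  field_simp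
  ring

theorem Gamma_mul_Gamma_mul_cos {a : ℂ} (h1 : -1 < a.re) (h2 : a.re < 1) :
    Complex.Gamma ((1 + a) / 2) * Complex.Gamma ((1 - a) / 2) * Complex.cos (a / 2 * Real.pi) = Real.pi := by
  have h := Complex.Gamma_mul_Gamma_one_sub ((1 + a) / 2)
  rw [show 1 - (1 + a) / 2 = (1 - a) / 2 by ring,
    show (Real.pi : ℂ) * ((1 + a) / 2) = a / 2 * Real.pi + Real.pi / 2 by ring,
    Complex.sin_add_pi_div_two] at h
  have hne : Complex.cos (a / 2 * Real.pi) ≠ 0 := by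
    intro h0
    rw [h0, div_zero] at h
    exact mul_ne_zero (Complex.Gamma_ne_zero_of_re_pos (by simp; linarith))
      (Complex.Gamma_ne_zero_of_re_pos (by simp; linarith)) h
  rw [h, div_mul_cancel₀ _ hne]

/-- Compares the coefficients of `e^{νs}` at `-∞` in the Lommel formula and in the integral, for `ν
= ±in`. Two reflection formulas do it: one for the cosine, one for `Γ(-ν) Γ(1+ν)`. -/
theorem connection_coefficient {μ ν : ℂ} (h1 : -1 < μ.re) (h2 : μ.re < 1) (hν : ν.re = 0)
    (hs : Complex.sin (Real.pi * ν) ≠ 0) :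
    -((2 : ℂ) ^ (μ - 1) * Complex.Gamma ((μ + ν + 1) / 2) * Complex.Gamma ((μ - ν + 1) / 2) *
        Complex.cos ((μ + ν) / 2 * Real.pi) / Complex.sin (Real.pi * ν)) / Complex.Gamma (ν + 1) =
      (2 : ℂ) ^ (μ + 1) / (Complex.Gamma ((1 - μ - ν) / 2) * Complex.Gamma ((1 - μ + ν) / 2)) *
        (1 / 4 * (Complex.Gamma (-ν) *
          (Complex.Gamma ((1 - (μ - ν)) / 2) * Complex.Gamma ((1 + (μ - ν)) / 2)))) := by
  have hc := Gamma_mul_Gamma_mul_cos (a := μ + ν) (by simp [hν, h1]) (by simp [hν, h2])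
  have hr := Complex.Gamma_mul_Gamma_one_sub (-ν)
  rw [sub_neg_eq_add, mul_neg, Complex.sin_neg, add_comm 1 ν, eq_div_iff (neg_ne_zero.2 hs)] at hr
  have hpow : (2 : ℂ) ^ (μ + 1) = 4 * 2 ^ (μ - 1) := by
    rw [show μ + 1 = (μ - 1) + (2 : ℕ) by push_cast; ring, Complex.cpow_add _ _ two_ne_zero,
      Complex.cpow_natCast]
    ring
  rw [show 1 - μ - ν = 1 - (μ + ν) by ring, show μ + ν + 1 = 1 + (μ + ν) by ring,
    show μ - ν + 1 = 1 + (μ - ν) by ring, show 1 - μ + ν = 1 - (μ - ν) by ring, hpow]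
  have g1 : Complex.Gamma ((1 - (μ + ν)) / 2) ≠ 0 :=
    Complex.Gamma_ne_zero_of_re_pos (by simp [hν]; linarith)
  have g2 : Complex.Gamma ((1 - (μ - ν)) / 2) ≠ 0 :=
    Complex.Gamma_ne_zero_of_re_pos (by simp [hν]; linarith)
  have g3 : Complex.Gamma (ν + 1) ≠ 0 := Complex.Gamma_ne_zero_of_re_pos (by simp [hν])
  generalize Complex.Gamma ((1 - (μ + ν)) / 2) = G1 at *
  generalize Complex.Gamma ((1 - (μ - ν)) / 2) = G2 at *
  generalize Complex.Gamma (ν + 1) = G3 at *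
  generalize Complex.Gamma ((1 + (μ + ν)) / 2) = H1 at *
  generalize Complex.Gamma ((1 + (μ - ν)) / 2) = H2 at *
  generalize Complex.Gamma (-ν) = H3 at *
  generalize Complex.cos ((μ + ν) / 2 * Real.pi) = T at *
  generalize Complex.sin (Real.pi * ν) = S at *
  field_simp
  linear_combination (-H2) * hc + H2 * hr

/-- The normalised integral that represents the Lommel function. -/
noncomputable def lommelRepr (n : ℝ) (s : ℝ) (μ : ℂ) : ℂ :=
  (2 : ℂ) ^ (μ + 1) / (Complex.Gamma ((1 - μ - Complex.I * n) / 2) *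
    Complex.Gamma ((1 - μ + Complex.I * n) / 2)) * lommelIntegral n μ s

theorem lommelSRegular_eq_lommelRepr_of_abs_re_lt_one {n : ℝ} (hn : 0 < n) {μ : ℂ} (h1 : -1 < μ.re)
    (h2 : μ.re < 1) (s : ℝ) :
    lommelSRegular μ (Complex.I * n) (Real.exp s) = lommelRepr n s μ := by
  have hI : (Complex.I * n) ^ 2 = -(n : ℂ) ^ 2 := by
    linear_combination ((n : ℂ) ^ 2) * Complex.I_sq
  have hsin := sin_pi_mul_I_mul_ne_zero hn.ne'
  have hp : Complex.Gamma ((1 - μ + Complex.I * n) / 2) ≠ 0 :=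
    Complex.Gamma_ne_zero_of_re_pos (by simp; linarith)
  have hq : Complex.Gamma ((1 - μ - Complex.I * n) / 2) ≠ 0 :=
    Complex.Gamma_ne_zero_of_re_pos (by simp; linarith)
  set c : ℂ := (2 : ℂ) ^ (μ + 1) / (Complex.Gamma ((1 - μ - Complex.I * n) / 2) *
    Complex.Gamma ((1 - μ + Complex.I * n) / 2)) with hc
  set A : ℂ := (2 : ℂ) ^ (μ - 1) * Complex.Gamma ((μ + Complex.I * n + 1) / 2) *
    Complex.Gamma ((μ - Complex.I * n + 1) / 2) with hA
  set a : ℂ := -(A * Complex.cos ((μ + Complex.I * n) / 2 * Real.pi) / Complex.sin (Real.pi * (Complex.I * n)))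
    with ha
  set b : ℂ := A * Complex.cos ((μ - Complex.I * n) / 2 * Real.pi) / Complex.sin (Real.pi * (Complex.I * n))
    with hb
  have hreg : ∀ s : ℝ, lommelSRegular μ (Complex.I * n) (Real.exp s) =
      lommels μ (Complex.I * n) (Real.exp s) + a * besselJ (Complex.I * n) (Real.exp s) +
        b * besselJ (-(Complex.I * n)) (Real.exp s) := by
    intro s
    rw [lommelSRegular, sin_mul_besselJ_sub_cos_mul_besselY hn.ne', ← hA, ha, hb]
    ring
  obtain ⟨cs, rs, cs0, es⟩ := lommels_exp_eq (n := n) h1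
  obtain ⟨cp, rp, cp0, ep⟩ := besselJ_exp_eq (n := n) (ν := Complex.I * n) hI (by simp)
  obtain ⟨cm, rm, cm0, em⟩ := besselJ_exp_eq (n := n) (ν := -(Complex.I * n)) (by rw [neg_sq, hI]) (by simp)
  obtain ⟨⟨s1, ds, ds1⟩, ts⟩ := bessel_frobenius (n := n) (α := μ + 1) (by simp; linarith) rs
  obtain ⟨⟨p1, dp, dp1⟩, tp⟩ := bessel_frobenius (n := n) (α := Complex.I * n) (by simp) rp
  obtain ⟨⟨m1, dm, dm1⟩, tm⟩ := bessel_frobenius (n := n) (α := -(Complex.I * n)) (by simp) rm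
  obtain ⟨F1, dF, dF1⟩ := lommelIntegral_ode hn h1 h2
  simp only [← es] at ds ds1 ts
  simp only [← ep] at dp dp1 tp
  simp only [← em] at dm dm1 tm
  -- With this normalisation both sides have the source `e^{(μ+1)s}`, so it cancels in the
  -- difference.
  have hM : c * ((2 : ℂ) ^ (-μ - 1) * (Complex.Gamma ((1 - μ - Complex.I * n) / 2) *
        Complex.Gamma ((1 - μ + Complex.I * n) / 2))) = 1 := by
    have h2 : (2 : ℂ) ^ (μ + 1) * 2 ^ (-μ - 1) = 1 := by
      rw [← Complex.cpow_add _ _ two_ne_zero, show μ + 1 + (-μ - 1) = 0 by ring, Complex.cpow_zero]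
    rw [hc]
    field_simp
    exact h2
  have hca : a / Complex.Gamma (Complex.I * n + 1) = c * (1 / 4 * (Complex.Gamma (-(Complex.I * n)) *
          (Complex.Gamma ((1 - (μ - Complex.I * n)) / 2) * Complex.Gamma ((1 + (μ - Complex.I * n)) / 2)))) :=
    connection_coefficient h1 h2 (by simp) hsin
  have hcb : b / Complex.Gamma (-(Complex.I * n) + 1) = c * (1 / 4 * (Complex.Gamma (Complex.I * n) *
          (Complex.Gamma ((1 - (μ + Complex.I * n)) / 2) * Complex.Gamma ((1 + (μ + Complex.I * n)) / 2)))) := by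
    have h := connection_coefficient (ν := -(Complex.I * n)) h1 h2 (by simp)
      (by rw [mul_neg, Complex.sin_neg]; exact neg_ne_zero.2 hsin)
    simp only [mul_neg, Complex.sin_neg, sub_neg_eq_add, ← sub_eq_add_neg, neg_neg, div_neg] at h
    rw [hb, hA, hc, mul_comm (Complex.Gamma ((1 - μ - Complex.I * n) / 2)), ← h]
    ring
  have key := eq_zero_of_bessel_ode hn
    (W := fun s : ℝ => lommels μ (Complex.I * n) (Real.exp s) + a * besselJ (Complex.I * n) (Real.exp s) +
        b * besselJ (-(Complex.I * n)) (Real.exp s) - c * lommelIntegral n μ s)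
    (W1 := fun s => s1 s + a * p1 s + b * m1 s - c * F1 s)
    (fun s => (((ds s).add ((dp s).const_mul a)).add ((dm s).const_mul b)).sub ((dF s).const_mul c))
    (fun s => ((((ds1 s).add ((dp1 s).const_mul a)).add ((dm1 s).const_mul b)).sub
      ((dF1 s).const_mul c)).congr_deriv ?_) ?_ s
  · rw [hreg, lommelRepr, ← hc]
    exact sub_eq_zero.1 key
  · rw [cs0, hI, neg_sq, hI]
    linear_combination (-Complex.exp ((μ + 1) * s)) * hM
  · have ts' : Tendsto (fun s : ℝ => lommels μ (Complex.I * n) (Real.exp s)) atBot (𝓝 0) := by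
      have h : Tendsto (fun s : ℝ => cs 0 * Complex.exp ((μ + 1) * s)) atBot (𝓝 (cs 0 * 0)) := by
        refine Tendsto.const_mul _ (tendsto_zero_iff_norm_tendsto_zero.2 ?_)
        have : ∀ s : ℝ, ‖Complex.exp ((μ + 1) * s)‖ = Real.exp ((μ.re + 1) * s) := by
          intro s; rw [Complex.norm_exp]; simp
        simp only [this]
        exact Real.tendsto_exp_atBot.comp (tendsto_id.const_mul_atBot (by linarith))
      have h' := ts.add h
      simpa using h'
    have tF := tendsto_lommelIntegral_sub_lead hn h1 h2
    have h := ((ts'.add (tp.const_mul a)).add (tm.const_mul b)).sub (tF.const_mul c)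
    simp only [mul_zero, add_zero, sub_zero] at h
    refine h.congr fun s => ?_
    have e1 : Complex.exp (Complex.I * n * (Real.log 2 - s)) =
        Complex.exp (-(-(Complex.I * n)) * Real.log 2) * Complex.exp (-(Complex.I * n) * s) := by
      rw [← Complex.exp_add]; ring_nf
    have e2 : Complex.exp (-(Complex.I * n) * (Real.log 2 - s)) =
        Complex.exp (-(Complex.I * n) * Real.log 2) * Complex.exp (Complex.I * n * s) := by
      rw [← Complex.exp_add]; ring_nf
    rw [integral_sechKernel_mul_lead hn.ne' h1 h2, cp0, cm0, e1, e2]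
    linear_combination (-(Complex.exp (-(Complex.I * n) * Real.log 2) * Complex.exp (Complex.I * n * s))) * hca -
      (Complex.exp (-(-(Complex.I * n)) * Real.log 2) * Complex.exp (-(Complex.I * n) * s)) * hcb

/-! ### Analytic continuation in `μ` to `-2 < Re μ < 1`. -/

/-- A domination uniform in `μ`; the weight `1 + |v|` covers both the integrand and its
`μ`-derivative. For `v ≤ 0` the kernel decays and `K_{in}` is bounded; for `v ≥ 0` the kernel may
grow like `e^v`, which the decay `e^{-4(s+v)}` of `K_{in}` outweighs. -/
theorem exists_sechKernel_mul_macdonald_le {n : ℝ} (hn : 0 < n) (s : ℝ) {b : ℝ} (hb0 : -1 / 2 < b) (hb : b < 1) :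
    ∃ D, ∀ μ : ℂ, -2 ≤ μ.re → μ.re ≤ b → ∀ v : ℝ,
      (1 + |v|) * (‖sechKernel μ v‖ * |macdonald n (s + v)|) ≤ D * Real.exp (-|(1 - b) / 2 * v|) := by
  obtain ⟨C0, hC0⟩ := exists_exp_mul_abs_macdonald_le hn 0
  obtain ⟨C4, hC4⟩ := exists_exp_mul_abs_macdonald_le hn 4
  simp only [Nat.cast_zero, zero_mul, Real.exp_zero, one_mul] at hC0
  push_cast at hC4
  have hC0' : 0 ≤ C0 := (abs_nonneg _).trans (hC0 0)
  have hC4' : 0 ≤ C4 := (mul_nonneg (Real.exp_pos _).le (abs_nonneg _)).trans (hC4 0)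
  set δ := (1 - b) / 2 with hδ
  have hδ0 : 0 < δ := by rw [hδ]; linarith
  refine ⟨(1 + 1 / δ) * (C0 + C4 * Real.exp (-(4 * s))), fun μ h1 h2 v => ?_⟩
  have hc := Real.cosh_pos v
  have a1 : 1 + |v| ≤ (1 + 1 / δ) * Real.exp (|δ * v|) := by
    have e1 := Real.add_one_le_exp (|δ * v|)
    rw [abs_mul, abs_of_pos hδ0] at e1 ⊢
    have e2 : |v| ≤ 1 / δ * Real.exp (δ * |v|) := by
      rw [div_mul_eq_mul_div, le_div_iff₀ hδ0]
      linarith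
    have e3 : 0 ≤ δ * |v| := by positivity
    linarith
  have a2 : ‖sechKernel μ v‖ * |macdonald n (s + v)| ≤
      (C0 + C4 * Real.exp (-(4 * s))) * Real.exp (-(2 * |δ * v|)) := by
    rw [norm_sechKernel, abs_mul, abs_of_pos hδ0]
    rcases le_total v 0 with hv | hv
    · rw [abs_of_nonpos hv]
      have e1 : Real.exp (-μ.re * v) / (2 * Real.cosh v) ≤ Real.exp (-(2 * (δ * -v))) := by
        rw [div_le_iff₀ (by positivity), Real.cosh_eq, mul_div_cancel₀ _ two_ne_zero, mul_add,
          ← Real.exp_add, ← Real.exp_add]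
        have : Real.exp (-μ.re * v) ≤ Real.exp (-(2 * (δ * -v)) + -v) := by
          gcongr; rw [hδ]; nlinarith
        linarith [Real.exp_pos (-(2 * (δ * -v)) + v)]
      calc _ ≤ Real.exp (-(2 * (δ * -v))) * C0 := by gcongr; exact hC0 _
        _ ≤ Real.exp (-(2 * (δ * -v))) * (C0 + C4 * Real.exp (-(4 * s))) := by
          gcongr; linarith [mul_nonneg hC4' (Real.exp_pos (-(4 * s))).le]
        _ = _ := mul_comm _ _
    · rw [abs_of_nonneg hv]
      have e1 : Real.exp (-μ.re * v) / (2 * Real.cosh v) ≤ Real.exp v := by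
        rw [div_le_iff₀ (by positivity), Real.cosh_eq, mul_div_cancel₀ _ two_ne_zero, mul_add,
          ← Real.exp_add, ← Real.exp_add]
        have : Real.exp (-μ.re * v) ≤ Real.exp (v + v) := by
          gcongr; nlinarith
        linarith [Real.exp_pos (v + -v)]
      have e2 : |macdonald n (s + v)| ≤ C4 * Real.exp (-(4 * (s + v))) := by
        rw [Real.exp_neg, ← div_eq_mul_inv, le_div_iff₀ (Real.exp_pos _), mul_comm]
        exact hC4 _
      calc _ ≤ Real.exp v * (C4 * Real.exp (-(4 * (s + v)))) := by gcongr
        _ = C4 * Real.exp (-(4 * s)) * Real.exp (-(3 * v)) := by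
          rw [mul_left_comm, ← Real.exp_add, mul_assoc, ← Real.exp_add]; ring_nf
        _ ≤ (C0 + C4 * Real.exp (-(4 * s))) * Real.exp (-(2 * (δ * v))) := by
          gcongr ?_ * Real.exp ?_
          · linarith
          · rw [hδ]; nlinarith
  calc _ ≤ (1 + 1 / δ) * Real.exp (|δ * v|) *
        ((C0 + C4 * Real.exp (-(4 * s))) * Real.exp (-(2 * |δ * v|))) := by gcongr
    _ = (1 + 1 / δ) * (C0 + C4 * Real.exp (-(4 * s))) * (Real.exp (|δ * v|) * Real.exp (-(2 * |δ * v|))) := by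
        ring
    _ = _ := by rw [← Real.exp_add]; ring_nf

theorem integrable_exp_neg_abs_mul {δ : ℝ} (hδ : 0 < δ) : Integrable fun v : ℝ => Real.exp (-|δ * v|) := by
  have h := ((integrable_sechKernel (μ := 0) (by simp) (by simp)).norm.comp_mul_left' hδ.ne').const_mul 2
  refine h.mono' (Continuous.aestronglyMeasurable (by fun_prop)) (Eventually.of_forall fun v => ?_)
  have hc := Real.cosh_pos (δ * v)
  rw [norm_sechKernel, Real.norm_of_nonneg (Real.exp_pos _).le, Real.exp_neg]
  simp only [Complex.zero_re, neg_zero, zero_mul, Real.exp_zero]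
  rw [mul_one_div, div_mul_cancel_left₀ two_ne_zero]
  gcongr
  rw [← Real.cosh_abs, Real.cosh_eq]
  have : Real.exp (-|δ * v|) ≤ Real.exp |δ * v| := by
    gcongr; linarith [abs_nonneg (δ * v)]
  linarith

theorem differentiableAt_lommelIntegral {n : ℝ} (hn : 0 < n) (s : ℝ) {μ₀ : ℂ} (h1 : -2 < μ₀.re) (h2 : μ₀.re < 1) :
    DifferentiableAt ℂ (fun μ => lommelIntegral n μ s) μ₀ := by
  have hk := continuous_macdonald n
  -- The midpoint of `Re μ₀` and `1`, so that a neighbourhood of `μ₀` lies to its left.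
  set b := (1 + μ₀.re) / 2 with hb
  obtain ⟨D, hD⟩ := exists_sechKernel_mul_macdonald_le hn s (b := b) (by rw [hb]; linarith) (by rw [hb]; linarith)
  have hI := (integrable_exp_neg_abs_mul (δ := (1 - b) / 2) (by rw [hb]; linarith)).const_mul D
  have hpos : ∀ (μ : ℂ) (v : ℝ), 0 ≤ ‖sechKernel μ v‖ * |macdonald n (s + v)| := fun μ v => by positivity
  refine (hasDerivAt_integral_of_dominated_loc_of_deriv_le (μ := volume)
    (s := Complex.re ⁻¹' Ioo (-2) b)
    (F := fun μ v => sechKernel μ v * (macdonald n (s + v) : ℂ))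
    (F' := fun μ v => -v * sechKernel μ v * (macdonald n (s + v) : ℂ))
    (bound := fun v => D * Real.exp (-|(1 - b) / 2 * v|))
    ((isOpen_Ioo.preimage Complex.continuous_re).mem_nhds ⟨h1, by rw [hb]; linarith⟩)
    (Eventually.of_forall fun μ => ?_) ?_ ?_
    (Eventually.of_forall fun v μ hμ => ?_) hI
    (Eventually.of_forall fun v μ hμ => ?_)).2.differentiableAt
  · have := continuous_sechKernel μ
    exact Continuous.aestronglyMeasurable (by fun_prop)
  · have := continuous_sechKernel μ₀
    refine hI.mono' (Continuous.aestronglyMeasurable (by fun_prop)) (Eventually.of_forall fun v => ?_)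
    rw [norm_mul, Complex.norm_real, Real.norm_eq_abs]
    refine le_trans ?_ (hD μ₀ h1.le (by rw [hb]; linarith) v)
    nlinarith [hpos μ₀ v, abs_nonneg v]
  · have := continuous_sechKernel μ₀
    exact Continuous.aestronglyMeasurable (by fun_prop)
  · rw [norm_mul, norm_mul, norm_neg, Complex.norm_real, Complex.norm_real, Real.norm_eq_abs, Real.norm_eq_abs]
    refine le_trans ?_ (hD μ hμ.1.le hμ.2.le v)
    nlinarith [hpos μ v, abs_nonneg v]
  · have h : HasDerivAt (fun μ : ℂ => -μ * v) (-1 * v) μ := ((hasDerivAt_id μ).neg).mul_const _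
    refine (((h.cexp).div_const ((2 * Real.cosh v : ℝ) : ℂ)).mul_const (macdonald n (s + v) : ℂ)).congr_deriv ?_
    simp only [sechKernel]
    ring

theorem differentiableAt_lommelRepr {n : ℝ} (hn : 0 < n) (s : ℝ) {μ₀ : ℂ} (h1 : -2 < μ₀.re) (h2 : μ₀.re < 1) :
    DifferentiableAt ℂ (lommelRepr n s) μ₀ := by
  have hG : ∀ z : ℂ, 0 < z.re → DifferentiableAt ℂ Complex.Gamma z := fun z hz =>
    Complex.differentiableAt_Gamma z fun m hm => by
      rw [hm] at hz
      simp at hz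
      linarith [Nat.cast_nonneg (α := ℝ) m]
  have hp : 0 < ((1 - μ₀ + Complex.I * n) / 2).re := by simp; linarith
  have hq : 0 < ((1 - μ₀ - Complex.I * n) / 2).re := by simp; linarith
  unfold lommelRepr
  refine (DifferentiableAt.div ?_ (DifferentiableAt.mul ?_ ?_) ?_).mul (differentiableAt_lommelIntegral hn s h1 h2)
  · exact (differentiableAt_id.add_const 1).const_cpow (Or.inl two_ne_zero)
  · exact (hG _ hq).comp μ₀ (f := fun μ => (1 - μ - Complex.I * n) / 2) (by fun_prop)
  · exact (hG _ hp).comp μ₀ (f := fun μ => (1 - μ + Complex.I * n) / 2) (by fun_prop)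
  · exact mul_ne_zero (Complex.Gamma_ne_zero_of_re_pos hq) (Complex.Gamma_ne_zero_of_re_pos hp)

/-- The product of `(μ + 1)² + n²` with the regular Lommel formula, free of poles for `-2 < Re μ`. -/
noncomputable def lommelEntire (n : ℝ) (z μ : ℂ) : ℂ :=
  z ^ (μ + 1) * (∑' k : ℕ, (-1 : ℂ) ^ k * z ^ (2 * k) /
      ∏ j ∈ Finset.range k, ((μ + (2 * j + 3 : ℕ)) ^ 2 + n ^ 2)) +
    (2 : ℂ) ^ (μ - 1) * 4 * Complex.Gamma ((μ + Complex.I * n + 3) / 2) *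
      Complex.Gamma ((μ - Complex.I * n + 3) / 2) *
      (Complex.sin ((μ - Complex.I * n) / 2 * Real.pi) * besselJ (Complex.I * n) z -
        Complex.cos ((μ - Complex.I * n) / 2 * Real.pi) * besselY (Complex.I * n) z)

theorem factorial_le_norm_prod (n : ℝ) {μ : ℂ} (hμ : -2 < μ.re) (k : ℕ) :
    (k.factorial : ℝ) ≤ ‖∏ j ∈ Finset.range k, ((μ + (2 * j + 3 : ℕ)) ^ 2 + (n : ℂ) ^ 2)‖ := by
  induction k with
  | zero => simp
  | succ k ih =>
    rw [Finset.prod_range_succ, norm_mul, Nat.factorial_succ, mul_comm (k + 1)]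
    push_cast
    have hre : (μ + (2 * k + 3 : ℕ)).re = μ.re + (2 * k + 3) := by simp
    have hk := Nat.cast_nonneg (α := ℝ) k
    have h1 := sq_re_le_norm_sq_add_sq (n := n) (z := μ + (2 * k + 3 : ℕ)) (by rw [hre]; linarith)
    rw [hre] at h1
    push_cast at h1 ih
    gcongr
    nlinarith

theorem differentiableOn_lommelEntire (n : ℝ) {z : ℂ} (hz : z ≠ 0) :
    DifferentiableOn ℂ (lommelEntire n z) (Complex.re ⁻¹' Ioo (-2) 1) := by
  have hopen : IsOpen (Complex.re ⁻¹' Ioo (-2) 1) := isOpen_Ioo.preimage Complex.continuous_re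
  have hG : ∀ z : ℂ, 0 < z.re → DifferentiableAt ℂ Complex.Gamma z := fun z hz =>
    Complex.differentiableAt_Gamma z fun m hm => by
      rw [hm] at hz
      simp at hz
      linarith [Nat.cast_nonneg (α := ℝ) m]
  have hT : DifferentiableOn ℂ (fun μ : ℂ => ∑' k : ℕ, (-1 : ℂ) ^ k * z ^ (2 * k) /
      ∏ j ∈ Finset.range k, ((μ + (2 * j + 3 : ℕ)) ^ 2 + (n : ℂ) ^ 2)) (Complex.re ⁻¹' Ioo (-2) 1) := by
    refine Complex.differentiableOn_tsum_of_summable_norm (u := fun k : ℕ => (‖z‖ ^ 2) ^ k / k.factorial)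
      (Real.summable_pow_div_factorial _) (fun k μ hμ => ?_) hopen (fun k μ hμ => ?_)
    · have hne : (∏ j ∈ Finset.range k, ((μ + (2 * j + 3 : ℕ)) ^ 2 + (n : ℂ) ^ 2)) ≠ 0 := by
        rw [← norm_pos_iff]
        exact lt_of_lt_of_le (by exact_mod_cast k.factorial_pos) (factorial_le_norm_prod n hμ.1 k)
      have hd : DifferentiableAt ℂ
          (fun μ : ℂ => ∏ j ∈ Finset.range k, ((μ + (2 * j + 3 : ℕ)) ^ 2 + (n : ℂ) ^ 2)) μ :=
        DifferentiableAt.fun_finsetProd fun j _ => by fun_prop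
      exact (DifferentiableAt.fun_div (by fun_prop) hd hne).differentiableWithinAt
    · rw [norm_div, norm_mul, norm_pow, norm_pow, norm_neg, norm_one, one_pow, one_mul, pow_mul]
      gcongr
      exact factorial_le_norm_prod n hμ.1 k
  intro μ hμ
  have hp : 0 < ((μ + Complex.I * n + 3) / 2).re := by simp; linarith [hμ.1]
  have hq : 0 < ((μ - Complex.I * n + 3) / 2).re := by simp; linarith [hμ.1]
  refine (DifferentiableAt.add (DifferentiableAt.mul ?_ (hT.differentiableAt (hopen.mem_nhds hμ)))
    (DifferentiableAt.mul (DifferentiableAt.mul (DifferentiableAt.mul (DifferentiableAt.mul ?_ (by fun_prop)) ?_) ?_)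
      (by fun_prop))).differentiableWithinAt
  · exact (differentiableAt_id.add_const 1).const_cpow (Or.inl hz)
  · exact (differentiableAt_id.sub_const 1).const_cpow (Or.inl two_ne_zero)
  · exact (hG _ hp).comp μ (f := fun μ => (μ + Complex.I * n + 3) / 2) (by fun_prop)
  · exact (hG _ hq).comp μ (f := fun μ => (μ - Complex.I * n + 3) / 2) (by fun_prop)

/-- The factor `(μ+1)² + n² = (μ+in+1)(μ-in+1)` cancels the `m = 1` term of every denominator and,
by `Γ(z+1) = zΓ(z)`, raises both Gamma arguments by one; the `4` comes from the two halvings. -/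
theorem lommelEntire_eq {n : ℝ} {μ : ℂ} (hμ : (μ + 1) ^ 2 + (n : ℂ) ^ 2 ≠ 0) (z : ℂ) :
    lommelEntire n z μ = ((μ + 1) ^ 2 + n ^ 2) * lommelSRegular μ (Complex.I * n) z := by
  have hI : (Complex.I * n) ^ 2 = -(n : ℂ) ^ 2 := by
    linear_combination ((n : ℂ) ^ 2) * Complex.I_sq
  have hfac : (μ + 1) ^ 2 + (n : ℂ) ^ 2 = (μ + Complex.I * n + 1) * (μ - Complex.I * n + 1) := by
    linear_combination hI
  have hne := hμ
  rw [hfac, mul_ne_zero_iff] at hne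
  have hprod : ∀ k : ℕ, ∏ m ∈ Finset.Icc 1 (k + 1), ((μ + 2 * (m : ℂ) - 1) ^ 2 - (Complex.I * n) ^ 2) =
      ((μ + 1) ^ 2 + n ^ 2) * ∏ j ∈ Finset.range k, ((μ + (2 * j + 3 : ℕ)) ^ 2 + (n : ℂ) ^ 2) := by
    intro k
    rw [hI]
    induction k with
    | zero => simp; ring
    | succ k ih =>
      rw [Finset.prod_Icc_succ_top (by omega), ih, Finset.prod_range_succ]
      push_cast
      ring
  have hser : ((μ + 1) ^ 2 + n ^ 2) * (∑' k : ℕ, (-1 : ℂ) ^ k * z ^ (2 * k) /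
      ∏ m ∈ Finset.Icc 1 (k + 1), ((μ + 2 * (m : ℂ) - 1) ^ 2 - (Complex.I * n) ^ 2)) =
      ∑' k : ℕ, (-1 : ℂ) ^ k * z ^ (2 * k) / ∏ j ∈ Finset.range k, ((μ + (2 * j + 3 : ℕ)) ^ 2 + (n : ℂ) ^ 2) := by
    rw [← tsum_mul_left]
    congr 1
    ext k
    rw [hprod, mul_div_assoc', mul_div_mul_left _ _ hμ]
  rw [lommelEntire, lommelSRegular, lommels, ← hser,
    show (μ + Complex.I * n + 3) / 2 = (μ + Complex.I * n + 1) / 2 + 1 by ring,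
    show (μ - Complex.I * n + 3) / 2 = (μ - Complex.I * n + 1) / 2 + 1 by ring,
    Complex.Gamma_add_one _ (div_ne_zero hne.1 two_ne_zero),
    Complex.Gamma_add_one _ (div_ne_zero hne.2 two_ne_zero), hfac]
  ring

theorem sq_add_sq_ne_zero_of_re {n : ℝ} {μ : ℂ} (h : -1 < μ.re) : (μ + 1) ^ 2 + (n : ℂ) ^ 2 ≠ 0 := by
  intro h0
  have h1 := sq_re_le_norm_sq_add_sq (n := n) (z := μ + 1) (by simp; linarith)
  rw [h0, norm_zero] at h1
  simp at h1
  nlinarith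

/-- The integral representation of `S_{μ,in}` at regular parameters with `-2 < Re μ < 1`. -/
theorem lommelSRegular_eq_lommelRepr {n : ℝ} (hn : 0 < n) {μ : ℂ} (h1 : -2 < μ.re) (h2 : μ.re < 1)
    (hμ : (μ + 1) ^ 2 + (n : ℂ) ^ 2 ≠ 0) (s : ℝ) :
    lommelSRegular μ (Complex.I * n) (Real.exp s) = lommelRepr n s μ := by
  have hopen : IsOpen (Complex.re ⁻¹' Ioo (-2) 1) := isOpen_Ioo.preimage Complex.continuous_re
  have hz : (Real.exp s : ℂ) ≠ 0 := by exact_mod_cast (Real.exp_pos s).ne'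
  have hpre : IsPreconnected (Complex.re ⁻¹' Ioo (-2) 1) :=
    ((convex_Ioo (-2 : ℝ) 1).linear_preimage Complex.reLm).isPreconnected
  have hR : DifferentiableOn ℂ (fun μ : ℂ => ((μ + 1) ^ 2 + (n : ℂ) ^ 2) * lommelRepr n s μ)
      (Complex.re ⁻¹' Ioo (-2) 1) := fun μ hμ =>
    (DifferentiableAt.mul (by fun_prop) (differentiableAt_lommelRepr hn s hμ.1 hμ.2)).differentiableWithinAt
  -- Identity theorem on the strip: the two pole-free functions agree near `0`, where `|Re ξ| < 1`.
  have key := ((differentiableOn_lommelEntire n hz).analyticOnNhd hopen).eqOn_of_preconnected_of_eventuallyEq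
    (hR.analyticOnNhd hopen) hpre (z₀ := 0) (by simp) (by
      filter_upwards [(isOpen_Ioo.preimage Complex.continuous_re).mem_nhds
        (show (0 : ℂ) ∈ Complex.re ⁻¹' Ioo (-1) 1 by simp)] with ξ hξ
      rw [lommelEntire_eq (sq_add_sq_ne_zero_of_re hξ.1),
        lommelSRegular_eq_lommelRepr_of_abs_re_lt_one hn hξ.1 hξ.2])
  have h := key (show μ ∈ Complex.re ⁻¹' Ioo (-2) 1 from ⟨h1, h2⟩)
  rw [lommelEntire_eq hμ] at h
  exact mul_left_cancel₀ hμ h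

/-- In this strip the only exceptional parameters are `-1 ± in`. The right side is continuous there,
so it gives the limit that defines `S` at these points. -/
theorem lommelS_eq_lommelRepr {n : ℝ} (hn : 0 < n) {μ : ℂ} (h1 : -2 < μ.re) (h2 : μ.re < 1) (s : ℝ) :
    lommelS μ (Complex.I * n) (Real.exp s) = lommelRepr n s μ := by
  have hI : (Complex.I * n) ^ 2 = -(n : ℂ) ^ 2 := by
    linear_combination ((n : ℂ) ^ 2) * Complex.I_sq
  have hfac : ∀ μ : ℂ, (μ + 1) ^ 2 + (n : ℂ) ^ 2 =
      (μ - (-1 - Complex.I * n)) * (μ - (-1 + Complex.I * n)) := by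
    intro μ
    linear_combination hI
  rw [lommelS]
  split_ifs with hex
  · refine Tendsto.limUnder_eq ?_
    refine ((differentiableAt_lommelRepr hn s h1 h2).continuousAt.tendsto.mono_left nhdsWithin_le_nhds).congr' ?_
    have hU : Complex.re ⁻¹' Ioo (-2) 1 ∈ 𝓝[≠] μ :=
      nhdsWithin_le_nhds ((isOpen_Ioo.preimage Complex.continuous_re).mem_nhds ⟨h1, h2⟩)
    have hne : ∀ r : ℂ, ∀ᶠ ξ in 𝓝[≠] μ, ξ ≠ r := by
      intro r
      rcases eq_or_ne μ r with h | h
      · rw [← h]; exact self_mem_nhdsWithin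
      · exact nhdsWithin_le_nhds (isOpen_ne.mem_nhds h)
    filter_upwards [hU, hne (-1 - Complex.I * n), hne (-1 + Complex.I * n)] with ξ hξ ha hb
    refine (lommelSRegular_eq_lommelRepr hn hξ.1 hξ.2 ?_ s).symm
    rw [hfac]
    exact mul_ne_zero (sub_ne_zero.2 ha) (sub_ne_zero.2 hb)
  · refine lommelSRegular_eq_lommelRepr hn h1 h2 (fun h0 => hex ⟨0, ?_⟩) s
    rw [hfac] at h0
    rcases mul_eq_zero.1 h0 with h | h
    · left
      push_cast
      linear_combination h
    · right
      push_cast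
      linear_combination h

/-! ### The uniform bound. -/

theorem corollary1 :
    ∃ C : ℝ, 0 < C ∧ ∀ (x : ℝ) (μ : ℂ) (n : ℕ),
      0 < x → -5 / 4 < μ.re → μ.re < 3 / 4 → 1 ≤ n →
        ‖lommelS μ (Complex.I * (n : ℂ)) (x : ℂ)‖ ≤
          C * x ^ (-(1 / 4) : ℝ) /
            (Real.sinh (Real.pi * n) ^ (1 / 2 : ℝ) *
              ‖Complex.Gamma ((1 - μ - Complex.I * (n : ℂ)) / 2) *
                Complex.Gamma ((1 - μ + Complex.I * (n : ℂ)) / 2)‖) := by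
  -- `80 = 4 · 20`: the `20` bounds the weighted integral of `K_{in}`, and `|2^{μ+1}| ≤ 2² = 4`.
  refine ⟨80, by norm_num, fun x μ n hx h1 h2 hn => ?_⟩
  have hn1 : (1 : ℝ) ≤ (n : ℝ) := by exact_mod_cast hn
  have hn0 : 0 < (n : ℝ) := by linarith
  have hS : 0 < Real.sinh (Real.pi * n) := Real.sinh_pos_iff.2 (by positivity)
  have hrep := lommelS_eq_lommelRepr hn0 (μ := μ) (by linarith) (by linarith) (Real.log x)
  rw [Real.exp_log hx, Complex.ofReal_natCast, lommelRepr, Complex.ofReal_natCast] at hrep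
  have hbound := norm_lommelIntegral_le hn1 h1.le h2.le (Real.log x)
  have hx4 : Real.exp (-(Real.log x / 4)) = x ^ (-(1 / 4) : ℝ) := by
    rw [Real.rpow_def_of_pos hx]
    ring_nf
  have hp : Complex.Gamma ((1 - μ + Complex.I * (n : ℂ)) / 2) ≠ 0 :=
    Complex.Gamma_ne_zero_of_re_pos (by simp; linarith)
  have hq : Complex.Gamma ((1 - μ - Complex.I * (n : ℂ)) / 2) ≠ 0 :=
    Complex.Gamma_ne_zero_of_re_pos (by simp; linarith)
  have hG := norm_pos_iff.2 (mul_ne_zero hq hp)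
  have h4 : ‖(2 : ℂ) ^ (μ + 1)‖ ≤ 4 := by
    rw [show (2 : ℂ) = ((2 : ℝ) : ℂ) by norm_num, Complex.norm_cpow_eq_rpow_re_of_pos two_pos]
    calc (2 : ℝ) ^ (μ + 1).re ≤ 2 ^ (2 : ℝ) := by
          gcongr
          · norm_num
          · simp; linarith
      _ = 4 := by norm_num
  rw [hx4] at hbound
  rw [← Real.sqrt_eq_rpow, le_div_iff₀ (mul_pos (Real.sqrt_pos.2 hS) hG), hrep, norm_mul, norm_div]
  calc _ = ‖(2 : ℂ) ^ (μ + 1)‖ * (Real.sqrt (Real.sinh (Real.pi * n)) * ‖lommelIntegral n μ (Real.log x)‖) := by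
        field_simp
    _ ≤ 4 * (20 * x ^ (-(1 / 4) : ℝ)) := by gcongr
    _ = _ := by ring
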